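/- Let $G$ be a finite connected graph cellularly embedded in the torus (for instance a square lattice with periodic boundary conditions), with one qubit on each edge. For a vertex $s$ let $A_s=\prod_{i\in\mathrm{legs}(s)}\sigma^x_i$, for a face $p$ let $B_p=\prod_{i\in\mathrm{boundary}(p)}\sigma^z_i$ (an edge occurring twice is counted twice), and let $H=-U\sum_s A_s-J\sum_p B_p$ with $U,J>0$ be the toric code Hamiltonian. Let the set of edges be partitioned into four regions $A_1,A_2,B_1,B_2$ such that: (i) the edges at each vertex, and the edges around each face, lie in at most two regions; (ii) each region is non-contractible, i.e. it supports a closed loop configuration of $\sigma^z$ operators that is not a product of plaquette operators, and a closed (dual) loop configuration of $\sigma^x$ operators that is not a product of star operators (loop configurations are taken modulo 2); (iii) the regions are arranged in the cyclic order $A_1,A_2,B_1,B_2$: the border between any two cyclically consecutive regions is a single simple closed curve, running alternately through vertices and faces, while $A_1,B_1$ share no border and $A_2,B_2$ share no border (no vertex or face is incident with edges of both). Let $A=A_1\cup A_2$ and $B=B_1\cup B_2$, and let $n_{A_2B_1}$ be the number of faces incident both with an edge of $A_2$ and with an edge of $B_1$. Let $|\psi\rangle$ be any normalized ground state of $H$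 and let $\rho_{AB_1}=\mathrm{tr}_{B_2}|\psi\rangle\langle\psi|$. Then its logarithmic negativity $E_{\mathcal N}^{A|B_1}(\rho_{AB_1})=\log_2\mathrm{tr}\left|\rho_{AB_1}^{T_A}\right|$, where $T_A$ is the partial transpose on $A$ and $|O|=\sqrt{O^\dagger O}$, is $$E_{\mathcal N}^{A|B_1}(\rho_{AB_1})=n_{A_2B_1}-1 .$$ In particular it does not depend on the choice of the ground state. -/

import Mathlib

namespace ToricCode

/-! ### Finite-dimensional quantum mechanics -/

/-- The tensor product over all sites `e : E` of the one-qubit operators `P e`, written as a matrix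
on the Hilbert space of one qubit per site, in the computational product basis `E → Fin 2`. -/
def siteTensor {E : Type*} [Fintype E] (P : E → Matrix (Fin 2) (Fin 2) ℂ) :
    Matrix (E → Fin 2) (E → Fin 2) ℂ :=
  Matrix.of fun a b => ∏ e, P e (a e) (b e)

/-- The Pauli matrix `σ^x`. -/
def sigmaX : Matrix (Fin 2) (Fin 2) ℂ := !![0, 1; 1, 0]

/-- The Pauli matrix `σ^z`. -/
def sigmaZ : Matrix (Fin 2) (Fin 2) ℂ := !![1, 0; 0, -1]

/-- `ψ` is a (normalised) ground state of the Hamiltonian `H`: a unit eigenvector for the least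
eigenvalue of `H`. -/
def IsGroundState {n : Type*} [Fintype n] (H : Matrix n n ℂ) (ψ : n → ℂ) : Prop :=
  ∑ i, ‖ψ i‖ ^ 2 = 1 ∧
    ∃ E₀ : ℝ, H.mulVec ψ = (E₀ : ℂ) • ψ ∧
      ∀ (E₁ : ℝ) (φ : n → ℂ), φ ≠ 0 → H.mulVec φ = (E₁ : ℂ) • φ → E₀ ≤ E₁

/-- The partial transpose with respect to the first tensor factor. -/
def partialTranspose {α β : Type*} (ρ : Matrix (α × β) (α × β) ℂ) :
    Matrix (α × β) (α × β) ℂ :=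
  Matrix.of fun i j => ρ (j.1, i.2) (i.1, j.2)

/-- The operator absolute value `|O| = √(O† O)`. -/
noncomputable def operatorAbs {n : Type*} [Fintype n] [DecidableEq n] (O : Matrix n n ℂ) :
    Matrix n n ℂ :=
  cfc Real.sqrt (O.conjTranspose * O)

/-- The logarithmic negativity `log₂ tr |ρ^{T_A}|` of a bipartite operator. -/
noncomputable def logNegativity {α β : Type*} [Fintype α] [Fintype β] [DecidableEq α]
    [DecidableEq β] (ρ : Matrix (α × β) (α × β) ℂ) : ℝ :=
  Real.logb 2 (operatorAbs (partialTranspose ρ)).trace.re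

/-! ### Lattices on closed oriented surfaces -/

/-- A finite connected graph with edge set `E`, cellularly embedded in a closed oriented surface and
given by its rotation system. The darts `(e, b)`, `b : Bool`, are the two orientations of the edge
`e`, and `rot` sends a dart to the next dart, counterclockwise, with the same source vertex. Every
such embedding is determined by its rotation system, and every rotation system arises. -/
structure SurfaceGraph (E : Type*) where
  rot : Equiv.Perm (E × Bool)
  nonempty : Nonempty E
  connected : ∀ d d' : E × Bool,
    Relation.ReflTransGen (fun a b : E × Bool => b = rot a ∨ b = (a.1, !a.2)) d d'

namespace SurfaceGraph

variable {E : Type*}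

/-- Reversal of darts. -/
def flip : Equiv.Perm (E × Bool) where
  toFun d := (d.1, !d.2)
  invFun d := (d.1, !d.2)
  left_inv d := by simp
  right_inv d := by simp

/-- The successor of a dart along the boundary of the face to its left. -/
def facePerm (G : SurfaceGraph E) : Equiv.Perm (E × Bool) := G.rot⁻¹ * flip

/-- Vertices are the orbits of the rotation. -/
def Vertex (G : SurfaceGraph E) : Type _ := Quotient (Equiv.Perm.SameCycle.setoid G.rot)

/-- Faces are the orbits of the face permutation. -/
def Face (G : SurfaceGraph E) : Type _ := Quotient (Equiv.Perm.SameCycle.setoid G.facePerm)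

/-- The source vertex of a dart. -/
def vertexOf (G : SurfaceGraph E) (d : E × Bool) : G.Vertex := Quotient.mk _ d

/-- The face to the left of a dart. -/
def faceOf (G : SurfaceGraph E) (d : E × Bool) : G.Face := Quotient.mk _ d

instance instFiniteVertex [Finite E] (G : SurfaceGraph E) : Finite G.Vertex :=
  inferInstanceAs (Finite (Quotient _))

instance instFiniteFace [Finite E] (G : SurfaceGraph E) : Finite G.Face :=
  inferInstanceAs (Finite (Quotient _))

noncomputable instance instFintypeVertex [Finite E] (G : SurfaceGraph E) : Fintype G.Vertex :=
  Fintype.ofFinite _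

noncomputable instance instFintypeFace [Finite E] (G : SurfaceGraph E) : Fintype G.Face :=
  Fintype.ofFinite _

noncomputable instance instDecidableEqVertex (G : SurfaceGraph E) : DecidableEq G.Vertex :=
  Classical.decEq _

noncomputable instance instDecidableEqFace (G : SurfaceGraph E) : DecidableEq G.Face :=
  Classical.decEq _

/-- The underlying closed (connected, oriented) surface is a torus: its Euler characteristic is
zero. -/
def IsTorus [Fintype E] (G : SurfaceGraph E) : Prop :=
  (Fintype.card G.Vertex : ℤ) - Fintype.card E + Fintype.card G.Face = 0

/-! ### The toric code Hamiltonian -/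

/-- The star operator `A_s`, the product of `σ^x` over the legs of the vertex `s` (an edge with both
ends at `s` counts as two legs). -/
noncomputable def starOp [Fintype E] (G : SurfaceGraph E) (s : G.Vertex) :
    Matrix (E → Fin 2) (E → Fin 2) ℂ :=
  siteTensor fun e => sigmaX ^ (Finset.univ.filter fun b : Bool => G.vertexOf (e, b) = s).card

/-- The plaquette operator `B_p`, the product of `σ^z` over the boundary of the face `p` (an edge
with `p` on both of its sides counts twice). -/
noncomputable def plaquetteOp [Fintype E] (G : SurfaceGraph E) (p : G.Face) :
    Matrix (E → Fin 2) (E → Fin 2) ℂ :=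
  siteTensor fun e => sigmaZ ^ (Finset.univ.filter fun b : Bool => G.faceOf (e, b) = p).card

/-- The toric code Hamiltonian `H = - U ∑ₛ Aₛ - J ∑ₚ Bₚ`. -/
noncomputable def hamiltonian [Fintype E] (G : SurfaceGraph E) (U J : ℝ) :
    Matrix (E → Fin 2) (E → Fin 2) ℂ :=
  -(U : ℂ) • ∑ s, G.starOp s - (J : ℂ) • ∑ p, G.plaquetteOp p

/-! ### Loops on the lattice and on the dual lattice -/

/-- `z` is a closed loop configuration on the lattice (the support of a `σ^z` loop operator): it
meets every vertex an even number of times. -/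
def IsLoop [Fintype E] (G : SurfaceGraph E) (z : E → ZMod 2) : Prop :=
  ∀ s : G.Vertex, ∑ d : E × Bool with G.vertexOf d = s, z d.1 = 0

/-- `z` is contractible: it is the boundary of a set of faces (a product of plaquette operators). -/
def IsContractibleLoop (G : SurfaceGraph E) (z : E → ZMod 2) : Prop :=
  ∃ f : G.Face → ZMod 2, ∀ e, z e = f (G.faceOf (e, false)) + f (G.faceOf (e, true))

/-- `w` is a closed loop configuration on the dual lattice (the support of a `σ^x` loop operator):
it meets every face an even number of times. -/
def IsDualLoop [Fintype E] (G : SurfaceGraph E) (w : E → ZMod 2) : Prop :=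
  ∀ p : G.Face, ∑ d : E × Bool with G.faceOf d = p, w d.1 = 0

/-- `w` is contractible on the dual lattice: it is a product of star operators. -/
def IsContractibleDualLoop (G : SurfaceGraph E) (w : E → ZMod 2) : Prop :=
  ∃ g : G.Vertex → ZMod 2, ∀ e, w e = g (G.vertexOf (e, false)) + g (G.vertexOf (e, true))

end SurfaceGraph

/-! ### Regions -/

/-- The labels of the four regions. -/
inductive Region where
  | A₁ | A₂ | B₁ | B₂
  deriving DecidableEq

namespace SurfaceGraph

variable {E : Type*}

/-- A set `R` of edges is a non-contractible region: it supports a non-contractible `σ^z` loop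
operator and a non-contractible `σ^x` loop operator. -/
def NonContractible [Fintype E] (G : SurfaceGraph E) (R : Set E) : Prop :=
  (∃ z : E → ZMod 2, G.IsLoop z ∧ (∀ e, z e ≠ 0 → e ∈ R) ∧ ¬ G.IsContractibleLoop z) ∧
  (∃ w : E → ZMod 2, G.IsDualLoop w ∧ (∀ e, w e ≠ 0 → e ∈ R) ∧ ¬ G.IsContractibleDualLoop w)

/-- The star at `s` touches the region `X`. -/
def StarTouches (G : SurfaceGraph E) (r : E → Region) (s : G.Vertex) (X : Region) : Prop :=
  ∃ d : E × Bool, G.vertexOf d = s ∧ r d.1 = X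

/-- The plaquette `p` touches the region `X`. -/
def PlaquetteTouches (G : SurfaceGraph E) (r : E → Region) (p : G.Face) (X : Region) : Prop :=
  ∃ d : E × Bool, G.faceOf d = p ∧ r d.1 = X

/-- The number `n_{XY}` of plaquettes spanning the boundary between the regions `X` and `Y`. -/
noncomputable def spanningPlaquettes (G : SurfaceGraph E) (r : E → Region) (X Y : Region) : ℕ :=
  {p : G.Face | G.PlaquetteTouches r p X ∧ G.PlaquetteTouches r p Y}.ncard

/-- The regions `X` and `Y` share no border. -/
def NoBorder (G : SurfaceGraph E) (r : E → Region) (X Y : Region) : Prop :=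
  (∀ s, ¬ (G.StarTouches r s X ∧ G.StarTouches r s Y)) ∧
    ∀ p, ¬ (G.PlaquetteTouches r p X ∧ G.PlaquetteTouches r p Y)

/-- The border between `X` and `Y`. The dart `d` stands for the corner between `d` and the next dart
`G.rot d` at the vertex `G.vertexOf d`; this corner lies in the face `G.faceOf d`. A corner belongs
to the border if one of its two edges is in `X` and the other one is in `Y`: there the border curve
runs from the vertex into the face. -/
def border (G : SurfaceGraph E) (r : E → Region) (X Y : Region) : Set (E × Bool) :=
  {d | (r d.1 = X ∧ r (G.rot d).1 = Y) ∨ (r d.1 = Y ∧ r (G.rot d).1 = X)}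

/-- A set `K` of corners forms a single simple closed curve, running alternately through vertices
and faces: it is non-empty and connected, and it passes exactly once through (that is, uses exactly
two corners of) every vertex and every face that it meets. -/
def IsSimpleClosedCurve (G : SurfaceGraph E) (K : Set (E × Bool)) : Prop :=
  K.Nonempty ∧
  (∀ d ∈ K, {d' ∈ K | G.vertexOf d' = G.vertexOf d}.ncard = 2 ∧
    {d' ∈ K | G.faceOf d' = G.faceOf d}.ncard = 2) ∧
  ∀ d ∈ K, ∀ d' ∈ K, Relation.ReflTransGen
    (fun a b => a ∈ K ∧ b ∈ K ∧ (G.vertexOf a = G.vertexOf b ∨ G.faceOf a = G.faceOf b)) d d'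

/-- The refined partition of the torus into `A = A₁ ∪ A₂` and `B = B₁ ∪ B₂`: four non-contractible
regions in the cyclic order `A₁, A₂, B₁, B₂`, cyclically consecutive ones sharing one boundary curve
and opposite ones sharing none, such that every star operator and every plaquette operator acts on
at most two regions. -/
structure IsRefinedPartition [Fintype E] (G : SurfaceGraph E) (r : E → Region) : Prop where
  star_le_two : ∀ s, {X | G.StarTouches r s X}.ncard ≤ 2
  plaquette_le_two : ∀ p, {X | G.PlaquetteTouches r p X}.ncard ≤ 2
  nonContractible : ∀ X, G.NonContractible {e | r e = X}
  border_A₁A₂ : G.IsSimpleClosedCurve (G.border r .A₁ .A₂)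
  border_A₂B₁ : G.IsSimpleClosedCurve (G.border r .A₂ .B₁)
  border_B₁B₂ : G.IsSimpleClosedCurve (G.border r .B₁ .B₂)
  border_B₂A₁ : G.IsSimpleClosedCurve (G.border r .B₂ .A₁)
  noBorder_A₁B₁ : G.NoBorder r .A₁ .B₁
  noBorder_A₂B₂ : G.NoBorder r .A₂ .B₂

end SurfaceGraph

section Reduced

variable {E : Type*}

/-- Basis configurations of the qubits in `A = A₁ ∪ A₂`. -/
abbrev ConfigA (r : E → Region) : Type _ := {e // r e = .A₁ ∨ r e = .A₂} → Fin 2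

/-- Basis configurations of the qubits in the single region `X`. -/
abbrev ConfigOf (r : E → Region) (X : Region) : Type _ := {e // r e = X} → Fin 2

/-- The configuration of all qubits assembled from configurations of `A`, `B₁` and `B₂`. -/
def glue (r : E → Region) (a : ConfigA r) (b : ConfigOf r .B₁) (c : ConfigOf r .B₂) :
    E → Fin 2 := fun e =>
  match h : r e with
  | .A₁ => a ⟨e, Or.inl h⟩
  | .A₂ => a ⟨e, Or.inr h⟩
  | .B₁ => b ⟨e, h⟩
  | .B₂ => c ⟨e, h⟩

/-- The reduced density matrix `ρ_{A B₁} = tr_{B₂} |ψ⟩⟨ψ|`, as an operator on the tensor product of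
the Hilbert spaces of `A` and of `B₁`. -/
noncomputable def reducedAB₁ [Fintype E] [DecidableEq E] (r : E → Region) (ψ : (E → Fin 2) → ℂ) :
    Matrix (ConfigA r × ConfigOf r .B₁) (ConfigA r × ConfigOf r .B₁) ℂ :=
  Matrix.of fun i j =>
    ∑ c : ConfigOf r .B₂, ψ (glue r i.1 i.2 c) * starRingEnd ℂ (ψ (glue r j.1 j.2 c))

/-- The logarithmic negativity `E_N^{A|B₁}(ρ_{A B₁})` of the state `ψ`. -/
noncomputable def logNegativityAB₁ [Fintype E] [DecidableEq E] (r : E → Region) (ψ : (E → Fin 2) → ℂ) : ℝ :=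
  logNegativity (reducedAB₁ r ψ)

end Reduced

end ToricCode

open scoped ComplexOrder

namespace ToricCode

/-! ### Trace norms of partially transposed coset states -/

/-! A ground state attains the extreme value of every term of the Hamiltonian. As a function on bit
strings it is therefore supported on the group `Z` of dual loops and invariant under the subgroup
`S` of contractible ones (`groundState_support_and_invariance`). Apart from its norm, nothing else
about the state enters, which explains why the choice of ground state does not matter.

Split a bit string as `(a, b, c)` over `A`, `B₁`, `B₂`. Let `K` be the group of `(a, b)` with `(a,
b, 0)` in `S`, let `Y` be the group of those `b` that close up to a dual loop `(0, b, c)` inside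
`B`, and let `L` be the part of `K` with `b` in `Y`. The reduced matrix is unchanged when both `B₁`
entries are translated by an element of `Y`, or when one index is translated by an element of `K`.
Modulo 2 this suffices to compute `|ρ^{T_A}|` explicitly: it is `1 / |L|` times `shiftedPinching`,
the sum over `K` of shifted copies of the part of `ρ` that is block diagonal for the cosets of `Y`.
That matrix is a Gram matrix, its square is the right one (`shiftedPinching_mul_self`) and its trace
is `|K|`, so `tr |ρ^{T_A}| = |K| / |L|` (`card_mul_trace_operatorAbs`).

The computation needs dual loops to be made contractible by changing them in a prescribed region. On
the torus `Z / S` has dimension two, and the dual loops avoiding a non-contractible region fall into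
only two classes, the nontrivial one being represented in any other region
(`IsTorus.exists_add_mem_contractibleDualLoops`).

It remains to find `|K| / |L|`. Send an element of `K` to the parities of its `B₁` part at the `n`
faces between `A₂` and `B₁`. The kernel is `L` (`borderSum_eq_zero_iff`). The image consists of the
vectors of even total parity (`mem_map_borderSum`): the border curve passes each of its vertices by
two corners, which forces evenness, and the star at such a vertex toggles the faces of these two
corners, which gives everything because the curve is connected. Hence the quotient is `2 ^ (n - 1)`;
the `-1` is this single parity constraint. -/

/-- The absolute value of `O` is the positive semidefinite square root of `O† O`. -/
theorem operatorAbs_eq_of_mul_self {n : Type*} [Fintype n] [DecidableEq n] {O R : Matrix n n ℂ}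
    (hR : R.PosSemidef) (h : R * R = O.conjTranspose * O) : operatorAbs O = R := by
  have hsa : IsSelfAdjoint R := hR.isHermitian
  unfold operatorAbs
  rw [← h, ← pow_two, ← cfc_comp_pow Real.sqrt 2 R]
  conv_rhs => rw [← cfc_id ℝ R]
  refine cfc_congr fun x hx => ?_
  have : 0 ≤ x := by
    have := hR.isHermitian.spectrum_real_eq_range_eigenvalues ▸ hx
    obtain ⟨i, rfl⟩ := this
    exact hR.eigenvalues_nonneg i
  simp [Real.sqrt_sq this]

section CosetState

variable {α β γ : Type*} [AddCommGroup α] [AddCommGroup β] [AddCommGroup γ]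

/-- The elements of `S` with vanishing third component. -/
def vanishingThird (S : AddSubgroup (α × β × γ)) : AddSubgroup (α × β) where
  carrier := {s | (s.1, s.2, (0 : γ)) ∈ S}
  add_mem' {a b} ha hb := by simpa using S.add_mem ha hb
  zero_mem' := S.zero_mem
  neg_mem' {a} ha := by simpa using S.neg_mem ha

/-- The second components of elements of `Z` with vanishing first component. -/
def secondOfVanishingFirst (Z : AddSubgroup (α × β × γ)) : AddSubgroup β where
  carrier := {b | ∃ c, ((0 : α), b, c) ∈ Z}
  add_mem' := by
    rintro a b ⟨c, hc⟩ ⟨d, hd⟩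
    exact ⟨c + d, by simpa using Z.add_mem hc hd⟩
  zero_mem' := ⟨0, Z.zero_mem⟩
  neg_mem' := by
    rintro a ⟨c, hc⟩
    exact ⟨-c, by simpa using Z.neg_mem hc⟩

/-- The elements `(a, b, 0)` of `S` such that `(0, b, c)` is in `Z` for some `c`. -/
def localShifts (Z S : AddSubgroup (α × β × γ)) : AddSubgroup (vanishingThird S) :=
  (secondOfVanishingFirst Z).comap ((AddMonoidHom.snd α β).comp (vanishingThird S).subtype)

theorem mem_localShifts {Z S : AddSubgroup (α × β × γ)} {s : vanishingThird S} :
    s ∈ localShifts Z S ↔ s.1.2 ∈ secondOfVanishingFirst Z := Iff.rfl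

theorem sub_mem_secondOfVanishingFirst {Z : AddSubgroup (α × β × γ)} {a : α} {b b' : β} {c c' : γ}
    (h : (a, b, c) ∈ Z) (h' : (a, b', c') ∈ Z) : b - b' ∈ secondOfVanishingFirst Z :=
  ⟨c - c', by simpa using Z.sub_mem h h'⟩

variable [Fintype γ]

/-- The reduced density matrix of `ψ` after tracing out the third factor. -/
noncomputable def partialTraceThird (ψ : α × β × γ → ℂ) : Matrix (α × β) (α × β) ℂ :=
  Matrix.of fun i j => ∑ c, ψ (i.1, i.2, c) * starRingEnd ℂ (ψ (j.1, j.2, c))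

omit [AddCommGroup α] [AddCommGroup β] [AddCommGroup γ] in
theorem star_partialTraceThird (ψ : α × β × γ → ℂ) (i j : α × β) :
    starRingEnd ℂ (partialTraceThird ψ i j) = partialTraceThird ψ j i := by
  simp [partialTraceThird, mul_comm]

variable {ψ : α × β × γ → ℂ} {Z S : AddSubgroup (α × β × γ)}

theorem mem_of_partialTraceThird_ne_zero (hsupp : ∀ z, ψ z ≠ 0 → z ∈ Z) {i j : α × β}
    (h : partialTraceThird ψ i j ≠ 0) : ∃ c, (i.1, i.2, c) ∈ Z ∧ (j.1, j.2, c) ∈ Z := by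
  obtain ⟨c, -, hc⟩ := Finset.exists_ne_zero_of_sum_ne_zero h
  refine ⟨c, hsupp _ (left_ne_zero_of_mul hc), hsupp _ ?_⟩
  simpa using right_ne_zero_of_mul hc

theorem partialTraceThird_add_left (hinv : ∀ s ∈ S, ∀ z, ψ (z + s) = ψ z) {s : α × β}
    (hs : s ∈ vanishingThird S) (i j : α × β) :
    partialTraceThird ψ (i + s) j = partialTraceThird ψ i j := by
  refine Finset.sum_congr rfl fun c _ => ?_
  have := hinv _ hs (i.1, i.2, c)
  simp only [Prod.mk_add_mk, add_zero] at this
  simp [this]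

theorem partialTraceThird_add_right (hinv : ∀ s ∈ S, ∀ z, ψ (z + s) = ψ z) {s : α × β}
    (hs : s ∈ vanishingThird S) (i j : α × β) :
    partialTraceThird ψ i (j + s) = partialTraceThird ψ i j := by
  rw [← star_partialTraceThird, partialTraceThird_add_left hinv hs, star_partialTraceThird]

/-- By `h1` the shift `v` extends to some `(0, v, c')` in `S`, and `c'` is absorbed by the sum over
the third component. -/
theorem partialTraceThird_add_add (hinv : ∀ s ∈ S, ∀ z, ψ (z + s) = ψ z)
    (h1 : ∀ b c, ((0 : α), b, c) ∈ Z → ∃ c', ((0 : α), b, c') ∈ S) {v : β}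
    (hv : v ∈ secondOfVanishingFirst Z) (a a' : α) (b b' : β) :
    partialTraceThird ψ (a, b + v) (a', b' + v) = partialTraceThird ψ (a, b) (a', b') := by
  obtain ⟨c, hc⟩ := hv
  obtain ⟨c', hc'⟩ := h1 _ _ hc
  simp only [partialTraceThird, Matrix.of_apply]
  rw [← Equiv.sum_comp (Equiv.addRight c')]
  refine Finset.sum_congr rfl fun c _ => ?_
  have e1 := hinv _ hc' (a, b, c)
  have e2 := hinv _ hc' (a', b', c)
  simp only [Prod.mk_add_mk, add_zero] at e1 e2
  simp [e1, e2]

/-- Together with Hermiticity this makes the entries real, although `ψ` may be complex. At a nonzero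
entry `h3` yields `(i - j, d)` in `S`; translating the summation variable by `d` interchanges the
roles of `i` and `j`, since `d + d = 0`. -/
theorem partialTraceThird_comm (hγ : ∀ c : γ, c + c = 0) (hsupp : ∀ z, ψ z ≠ 0 → z ∈ Z)
    (hinv : ∀ s ∈ S, ∀ z, ψ (z + s) = ψ z)
    (h3 : ∀ a b, (a, b, (0 : γ)) ∈ Z → ∃ c, (a, b, c) ∈ S) (i j : α × β) :
    partialTraceThird ψ i j = partialTraceThird ψ j i := by
  have key : ∀ i j, partialTraceThird ψ i j ≠ 0 →
      partialTraceThird ψ i j = partialTraceThird ψ j i := by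
    intro i j h
    obtain ⟨c, hc, hc'⟩ := mem_of_partialTraceThird_ne_zero hsupp h
    obtain ⟨d, hd⟩ := h3 (i.1 - j.1) (i.2 - j.2) (by simpa using Z.sub_mem hc hc')
    have e : ∀ c, ψ (i.1, i.2, c + d) = ψ (j.1, j.2, c) := fun c => by
      rw [← hinv _ hd (j.1, j.2, c)]
      simp
    have e' : ∀ c, ψ (i.1, i.2, c) = ψ (j.1, j.2, c - d) := fun c => by
      rw [← e, sub_add_cancel]
    have hd2 : ∀ c : γ, c - d = c + d := fun c => by
      rw [sub_eq_iff_eq_add, add_assoc, hγ, add_zero]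
    simp only [partialTraceThird, Matrix.of_apply]
    rw [← Equiv.sum_comp (Equiv.addRight d)]
    refine Finset.sum_congr rfl fun c _ => ?_
    simp only [Equiv.coe_addRight]
    rw [e, e' c, hd2]
  by_cases h : partialTraceThird ψ i j = 0
  · by_cases h' : partialTraceThird ψ j i = 0
    · rw [h, h']
    · exact (key _ _ h').symm
  · exact key _ _ h

variable [Fintype α] [Fintype β]

open Classical in
/-- The absolute value of the partial transpose of `partialTraceThird ψ`, up to normalisation, for a
state `ψ` supported on `Z` and invariant under `S`: the sum over the shifts by elements of `S` of
the pinching of `partialTraceThird ψ`. -/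
noncomputable def shiftedPinching (ψ : α × β × γ → ℂ) (Z S : AddSubgroup (α × β × γ)) :
    Matrix (α × β) (α × β) ℂ :=
  Matrix.of fun i j => ∑ s : vanishingThird S,
    if i.2 - j.2 ∈ secondOfVanishingFirst Z then
      partialTraceThird ψ (i.1, i.2 + s.1.2) (j.1, j.2 + s.1.2) else 0

/-- A Gram matrix: the columns of `F` are indexed by a shift, a third component and a coset of
`secondOfVanishingFirst Z`, the coset index producing the pinching. -/
theorem shiftedPinching_posSemidef (ψ : α × β × γ → ℂ) (Z S : AddSubgroup (α × β × γ)) :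
    (shiftedPinching ψ Z S).PosSemidef := by
  classical
  have : Fintype (β ⧸ secondOfVanishingFirst Z) := Fintype.ofFinite _
  let F : Matrix (α × β) (vanishingThird S × γ × (β ⧸ secondOfVanishingFirst Z)) ℂ :=
    Matrix.of fun i t => if (QuotientAddGroup.mk i.2 : β ⧸ secondOfVanishingFirst Z) = t.2.2 then
      ψ (i.1, i.2 + t.1.1.2, t.2.1) else 0
  have : shiftedPinching ψ Z S = F * F.conjTranspose := by
    ext i j
    simp only [shiftedPinching, Matrix.of_apply, Matrix.mul_apply, Matrix.conjTranspose_apply, F,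
      Fintype.sum_prod_type]
    refine Finset.sum_congr rfl fun s _ => ?_
    rw [Finset.sum_comm]
    rw [Finset.sum_eq_single (QuotientAddGroup.mk i.2 : β ⧸ secondOfVanishingFirst Z)]
    · have : (QuotientAddGroup.mk j.2 : β ⧸ secondOfVanishingFirst Z) = QuotientAddGroup.mk i.2 ↔
          i.2 - j.2 ∈ secondOfVanishingFirst Z := by
        rw [QuotientAddGroup.eq, sub_eq_neg_add]
      simp only [this]
      split_ifs with h <;> simp [partialTraceThird]
    · intro q _ hq
      simp [hq.symm]
    · simp
  rw [this]
  exact Matrix.posSemidef_self_mul_conjTranspose F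

/-- Once `s` moves `j` into the support, a further shift contributes the same term if it lies in
`localShifts Z S` and zero otherwise, because elements of `Z` with equal first component differ in
the second by `secondOfVanishingFirst Z`. -/
theorem shiftedPinching_apply (hsupp : ∀ z, ψ z ≠ 0 → z ∈ Z)
    (hinv : ∀ s ∈ S, ∀ z, ψ (z + s) = ψ z)
    (h1 : ∀ b c, ((0 : α), b, c) ∈ Z → ∃ c', ((0 : α), b, c') ∈ S)
    {i j : α × β} {s : α × β} (hs : s ∈ vanishingThird S)
    (hij : i.2 - j.2 ∈ secondOfVanishingFirst Z) (hj : ∃ c, (j.1, j.2 + s.2, c) ∈ Z) :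
    shiftedPinching ψ Z S i j = (Nat.card (localShifts Z S) : ℂ) *
      partialTraceThird ψ (i.1, i.2 + s.2) (j.1, j.2 + s.2) := by
  classical
  simp only [shiftedPinching, Matrix.of_apply, if_pos hij]
  rw [← Equiv.sum_comp (Equiv.addLeft (⟨s, hs⟩ : vanishingThird S))]
  have : ∀ t : vanishingThird S,
      partialTraceThird ψ (i.1, i.2 + (Equiv.addLeft (⟨s, hs⟩ : vanishingThird S) t).1.2)
        (j.1, j.2 + (Equiv.addLeft (⟨s, hs⟩ : vanishingThird S) t).1.2) =
      if t ∈ localShifts Z S then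
        partialTraceThird ψ (i.1, i.2 + s.2) (j.1, j.2 + s.2) else 0 := by
    intro t
    simp only [mem_localShifts, Equiv.coe_addLeft, AddSubgroup.coe_add, Prod.snd_add, ← add_assoc]
    split_ifs with ht
    · exact partialTraceThird_add_add hinv h1 ht _ _ _ _
    · by_contra hne
      obtain ⟨c, -, hc⟩ := mem_of_partialTraceThird_ne_zero hsupp hne
      obtain ⟨c', hc'⟩ := hj
      exact ht (by simpa using sub_mem_secondOfVanishingFirst hc hc')
  simp only [this]
  rw [← Finset.sum_filter, Finset.sum_const, nsmul_eq_mul, ← Fintype.card_subtype,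
    Nat.card_eq_fintype_card]

theorem shiftedPinching_mul_self (hβ : ∀ b : β, b + b = 0) (hγ : ∀ c : γ, c + c = 0)
    (hsupp : ∀ z, ψ z ≠ 0 → z ∈ Z) (hinv : ∀ s ∈ S, ∀ z, ψ (z + s) = ψ z)
    (h1 : ∀ b c, ((0 : α), b, c) ∈ Z → ∃ c', ((0 : α), b, c') ∈ S)
    (h2 : ∀ a b, (a, b, (0 : γ)) ∈ Z → ∃ a', (a', b, (0 : γ)) ∈ S)
    (h3 : ∀ a b, (a, b, (0 : γ)) ∈ Z → ∃ c, (a, b, c) ∈ S) :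
    shiftedPinching ψ Z S * shiftedPinching ψ Z S =
      (Nat.card (localShifts Z S) : ℂ) ^ 2 •
        ((partialTranspose (partialTraceThird ψ)).conjTranspose *
          partialTranspose (partialTraceThird ψ)) := by
  classical
  have hsub : ∀ b b' : β, b - b' = b + b' := fun b b' => by
    rw [sub_eq_iff_eq_add, add_assoc, hβ, add_zero]
  have hcomm := partialTraceThird_comm hγ hsupp hinv h3
  have hYadd : ∀ {b b' b'' : β}, b - b' ∈ secondOfVanishingFirst Z →
      b' - b'' ∈ secondOfVanishingFirst Z → b - b'' ∈ secondOfVanishingFirst Z := by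
    intro b b' b'' h h'
    simpa using add_mem h h'
  ext i j
  rw [Matrix.smul_apply, Matrix.mul_apply, Matrix.mul_apply]
  simp only [Matrix.conjTranspose_apply, partialTranspose, Matrix.of_apply, smul_eq_mul]
  simp only [← starRingEnd_apply, star_partialTraceThird]
  -- Both entries vanish unless `hA` holds; when it holds, the two sums over `m` agree term by term
  -- after a reindexing.
  by_cases hA : (∃ s ∈ vanishingThird S, ∃ c, (j.1, j.2 + s.2, c) ∈ Z) ∧
      i.2 - j.2 ∈ secondOfVanishingFirst Z
  · obtain ⟨⟨s, hs, hj⟩, hij⟩ := hA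
    -- Shifting the two components of `m` by `-s.1` and `s.2` lets invariance under `s` put the same
    -- shift `s.2` on every `B₁` entry.
    rw [← Equiv.sum_comp ((Equiv.subRight s.1).prodCongr (Equiv.addRight s.2))
      (fun m : α × β => partialTraceThird ψ (m.1, i.2) (i.1, m.2) *
        partialTraceThird ψ (j.1, m.2) (m.1, j.2)), Finset.mul_sum]
    refine Finset.sum_congr rfl fun m _ => ?_
    simp only [Equiv.prodCongr_apply, Prod.map_fst, Prod.map_snd, Equiv.subRight_apply,
      Equiv.coe_addRight]
    have f1 : partialTraceThird ψ (m.1 - s.1, i.2) (i.1, m.2 + s.2) =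
        partialTraceThird ψ (m.1, i.2 + s.2) (i.1, m.2 + s.2) := by
      rw [← partialTraceThird_add_left hinv hs (m.1 - s.1, i.2)]
      simp [Prod.add_def]
    have f2 : partialTraceThird ψ (j.1, m.2 + s.2) (m.1 - s.1, j.2) =
        partialTraceThird ψ (j.1, m.2 + s.2) (m.1, j.2 + s.2) := by
      rw [← partialTraceThird_add_right hinv hs _ (m.1 - s.1, j.2)]
      simp [Prod.add_def]
    rw [f1, f2]
    by_cases hm : m.2 - j.2 ∈ secondOfVanishingFirst Z
    · have him : i.2 - m.2 ∈ secondOfVanishingFirst Z := by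
        simpa using sub_mem hij hm
      -- Translating both entries by `b - b' = b + b'` interchanges `b` and `b'`, which undoes the
      -- partial transpose inside a coset.
      have swap : ∀ (a a' : α) {b b' : β}, b - b' ∈ secondOfVanishingFirst Z →
          partialTraceThird ψ (a, b + s.2) (a', b' + s.2) =
          partialTraceThird ψ (a, b' + s.2) (a', b + s.2) := by
        intro a a' b b' h
        rw [← partialTraceThird_add_add hinv h1 h, hsub]
        have e1 : b + s.2 + (b + b') = b' + s.2 := by
          rw [show b + s.2 + (b + b') = (b + b) + (b' + s.2) by abel, hβ, zero_add]
        have e2 : b' + s.2 + (b + b') = b + s.2 := by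
          rw [show b' + s.2 + (b + b') = (b' + b') + (b + s.2) by abel, hβ, zero_add]
        rw [e1, e2]
      rw [shiftedPinching_apply hsupp hinv h1 hs hm hj, swap j.1 m.1 hm, swap m.1 i.1 him,
        hcomm (j.1, _), hcomm (m.1, m.2 + s.2) (i.1, _)]
      by_cases h0 : partialTraceThird ψ (m.1, m.2 + s.2) (j.1, j.2 + s.2) = 0
      · simp [h0]
      obtain ⟨c, hc, -⟩ := mem_of_partialTraceThird_ne_zero hsupp h0
      rw [shiftedPinching_apply hsupp hinv h1 hs him ⟨c, hc⟩]
      ring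
    · have z1 : shiftedPinching ψ Z S m j = 0 := by
        simp [shiftedPinching, hm]
      have z2 : partialTraceThird ψ (j.1, m.2 + s.2) (m.1, j.2 + s.2) = 0 := by
        by_contra hne
        obtain ⟨c, hc, -⟩ := mem_of_partialTraceThird_ne_zero hsupp hne
        obtain ⟨c', hc'⟩ := hj
        exact hm (by simpa using sub_mem_secondOfVanishingFirst hc hc')
      simp [z1, z2]
  · rw [Finset.sum_eq_zero, Finset.sum_eq_zero, mul_zero]
    · intro m _
      by_contra hne
      refine hA ⟨?_, ?_⟩
      · obtain ⟨c, hc, hc'⟩ := mem_of_partialTraceThird_ne_zero hsupp (right_ne_zero_of_mul hne)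
        -- `h2` makes the difference of the two elements of `Z` an element of `S` by changing only
        -- its first component; its second component carries `j.2` to `m.2`.
        obtain ⟨a', ha'⟩ := h2 (j.1 - m.1) (m.2 - j.2) (by simpa using Z.sub_mem hc hc')
        exact ⟨(a', m.2 - j.2), ha', c, by simpa using hc⟩
      · have hl := left_ne_zero_of_mul hne
        obtain ⟨c, hc, -⟩ := mem_of_partialTraceThird_ne_zero hsupp hl
        obtain ⟨c', -, hc'⟩ := mem_of_partialTraceThird_ne_zero hsupp (right_ne_zero_of_mul hne)
        exact sub_mem_secondOfVanishingFirst hc hc'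
    · intro m _
      by_contra hne
      have him : i.2 - m.2 ∈ secondOfVanishingFirst Z := by
        by_contra h
        exact hne (by simp [shiftedPinching, h])
      have hmj : m.2 - j.2 ∈ secondOfVanishingFirst Z := by
        by_contra h
        exact hne (by simp [shiftedPinching, h])
      refine hA ⟨?_, hYadd him hmj⟩
      have := right_ne_zero_of_mul hne
      simp only [shiftedPinching, Matrix.of_apply, if_pos hmj] at this
      obtain ⟨s, -, hs⟩ := Finset.exists_ne_zero_of_sum_ne_zero this
      obtain ⟨c, -, hc⟩ := mem_of_partialTraceThird_ne_zero hsupp hs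
      exact ⟨s.1, s.2, c, hc⟩

/-- On the diagonal the pinching condition is void, and each shift merely permutes the diagonal
entries of the reduced matrix. -/
theorem trace_shiftedPinching (ψ : α × β × γ → ℂ) (Z S : AddSubgroup (α × β × γ)) :
    (shiftedPinching ψ Z S).trace =
      (Nat.card (vanishingThird S) : ℂ) * ((∑ z, ‖ψ z‖ ^ 2 : ℝ) : ℂ) := by
  classical
  simp only [Matrix.trace, Matrix.diag_apply, shiftedPinching, Matrix.of_apply, sub_self, zero_mem,
    if_true]
  rw [Finset.sum_comm]
  have : ∀ s : vanishingThird S, ∑ i : α × β,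
      partialTraceThird ψ (i.1, i.2 + s.1.2) (i.1, i.2 + s.1.2) =
        ((∑ z, ‖ψ z‖ ^ 2 : ℝ) : ℂ) := by
    intro s
    refine (Equiv.sum_comp ((Equiv.refl α).prodCongr (Equiv.addRight s.1.2))
      (fun i => partialTraceThird ψ i i)).trans ?_
    simp only [partialTraceThird, Matrix.of_apply, Complex.mul_conj, Complex.normSq_eq_norm_sq,
      Fintype.sum_prod_type]
    push_cast
    rfl
  simp only [this, Finset.sum_const, Finset.card_univ, nsmul_eq_mul, Nat.card_eq_fintype_card]

/-- The trace norm of the partial transpose of the reduced density matrix of a state `ψ` which is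
supported on the subgroup `Z` and invariant under the subgroup `S`. -/
theorem card_mul_trace_operatorAbs [DecidableEq α] [DecidableEq β] (hβ : ∀ b : β, b + b = 0)
    (hγ : ∀ c : γ, c + c = 0)
    (hsupp : ∀ z, ψ z ≠ 0 → z ∈ Z) (hinv : ∀ s ∈ S, ∀ z, ψ (z + s) = ψ z)
    (h1 : ∀ b c, ((0 : α), b, c) ∈ Z → ∃ c', ((0 : α), b, c') ∈ S)
    (h2 : ∀ a b, (a, b, (0 : γ)) ∈ Z → ∃ a', (a', b, (0 : γ)) ∈ S)
    (h3 : ∀ a b, (a, b, (0 : γ)) ∈ Z → ∃ c, (a, b, c) ∈ S) (hnorm : ∑ z, ‖ψ z‖ ^ 2 = 1) :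
    (Nat.card (localShifts Z S) : ℝ) *
        (operatorAbs (partialTranspose (partialTraceThird ψ))).trace.re =
      (Nat.card (vanishingThird S) : ℝ) := by
  have hN : (Nat.card (localShifts Z S) : ℝ) ≠ 0 := by exact_mod_cast Nat.card_pos.ne'
  obtain ⟨N, hNdef⟩ : ∃ N : ℝ, (Nat.card (localShifts Z S) : ℝ) = N := ⟨_, rfl⟩
  rw [hNdef] at hN ⊢
  have hNC : (N : ℂ) ≠ 0 := by exact_mod_cast hN
  have hR : ((N⁻¹ : ℝ) • shiftedPinching ψ Z S).PosSemidef :=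
    (shiftedPinching_posSemidef ψ Z S).smul (inv_nonneg.2 (hNdef ▸ Nat.cast_nonneg _))
  have hmul : ((N⁻¹ : ℝ) • shiftedPinching ψ Z S) * ((N⁻¹ : ℝ) • shiftedPinching ψ Z S) =
      (partialTranspose (partialTraceThird ψ)).conjTranspose *
        partialTranspose (partialTraceThird ψ) := by
    rw [smul_mul_smul_comm, shiftedPinching_mul_self hβ hγ hsupp hinv h1 h2 h3]
    ext i j
    simp only [Matrix.smul_apply, Complex.real_smul, smul_eq_mul]
    rw [← Complex.ofReal_natCast, hNdef, ← mul_assoc]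
    push_cast
    field_simp
  rw [operatorAbs_eq_of_mul_self hR hmul, Matrix.trace_smul, trace_shiftedPinching, hnorm]
  simp only [Complex.ofReal_one, mul_one, Complex.real_smul, Complex.re_ofReal_mul,
    Complex.natCast_re]
  field_simp

end CosetState
end ToricCode

namespace ToricCode

/-! ### Corners, darts and coboundaries -/

namespace SurfaceGraph

variable {E : Type*} (G : SurfaceGraph E)

theorem vertexOf_rot (d : E × Bool) : G.vertexOf (G.rot d) = G.vertexOf d :=
  Quotient.sound (⟨-1, by simp⟩ : Equiv.Perm.SameCycle G.rot (G.rot d) d)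

theorem faceOf_facePerm (d : E × Bool) : G.faceOf (G.facePerm d) = G.faceOf d :=
  Quotient.sound (⟨-1, by simp⟩ : Equiv.Perm.SameCycle G.facePerm (G.facePerm d) d)

@[simp]
theorem rot_facePerm (d : E × Bool) : G.rot (G.facePerm d) = flip d := by
  simp [facePerm]

@[simp]
theorem flip_flip (d : E × Bool) : flip (flip d) = d := by
  simp [flip]

@[simp]
theorem facePerm_flip_rot (d : E × Bool) : G.facePerm (flip (G.rot d)) = d := by
  simp [facePerm]

theorem vertexOf_facePerm (d : E × Bool) : G.vertexOf (G.facePerm d) = G.vertexOf (flip d) := by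
  rw [← vertexOf_rot, rot_facePerm]

theorem faceOf_flip_rot (d : E × Bool) : G.faceOf (flip (G.rot d)) = G.faceOf d := by
  rw [← faceOf_facePerm, facePerm_flip_rot]

/-- The coboundary of a `ZMod 2`-valued function on vertices. -/
def coboundary (g : G.Vertex → ZMod 2) (e : E) : ZMod 2 :=
  g (G.vertexOf (e, false)) + g (G.vertexOf (e, true))

theorem coboundary_fst (g : G.Vertex → ZMod 2) (d : E × Bool) :
    G.coboundary g d.1 = g (G.vertexOf d) + g (G.vertexOf (flip d)) := by
  obtain ⟨e, b⟩ := d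
  cases b <;> simp [coboundary, flip, add_comm]

theorem sum_face_comp_facePerm [Fintype E] {M : Type*} [AddCommMonoid M] (f : E × Bool → M)
    (p : G.Face) : ∑ d with G.faceOf d = p, f (G.facePerm d) = ∑ d with G.faceOf d = p, f d := by
  simp only [Finset.sum_filter]
  rw [← Equiv.sum_comp G.facePerm fun d => if G.faceOf d = p then f d else 0]
  simp only [faceOf_facePerm]

/-- Summation by parts along the boundary of a face. -/
theorem sum_face_mul_coboundary [Fintype E] (χ : E → ZMod 2) (g : G.Vertex → ZMod 2) (p : G.Face) :
    ∑ d with G.faceOf d = p, χ d.1 * G.coboundary g d.1 =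
      ∑ d with G.faceOf d = p, (χ d.1 + χ (G.rot d).1) * g (G.vertexOf d) := by
  -- The far end of a dart is the source of the next dart of the face, so half of the sum is
  -- reindexed by `facePerm`.
  simp only [coboundary_fst, ← vertexOf_facePerm, mul_add, add_mul, Finset.sum_add_distrib]
  congr 1
  rw [← G.sum_face_comp_facePerm (fun d => χ (G.rot d).1 * g (G.vertexOf d))]
  simp only [rot_facePerm]
  rfl

theorem isDualLoop_coboundary [Fintype E] (g : G.Vertex → ZMod 2) :
    G.IsDualLoop (G.coboundary g) := by
  intro p
  have := G.sum_face_mul_coboundary (fun _ => 1) g p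
  simpa [CharTwo.add_self_eq_zero] using this

theorem coboundary_add (g g' : G.Vertex → ZMod 2) :
    G.coboundary (g + g') = G.coboundary g + G.coboundary g' := by
  ext e
  simp only [coboundary, Pi.add_apply]
  ring

theorem coboundary_zero : G.coboundary 0 = 0 := by
  ext e
  simp [coboundary]

/-- The incidence vector of a vertex, modulo 2. -/
noncomputable def starVec (s : G.Vertex) (e : E) : ZMod 2 :=
  ((Finset.univ.filter fun b : Bool => G.vertexOf (e, b) = s).card : ZMod 2)

theorem coboundary_single (s : G.Vertex) : G.coboundary (Pi.single s 1) = G.starVec s := by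
  ext e
  rw [starVec, Finset.card_filter]
  push_cast
  simp [-Finset.sum_boole, coboundary, Pi.single_apply, add_comm]

theorem coboundary_eq_sum [Finite E] (g : G.Vertex → ZMod 2) :
    G.coboundary g = ∑ s, g s • G.starVec s := by
  conv_lhs => rw [← Finset.univ_sum_single g]
  have : ∀ t : Finset G.Vertex, G.coboundary (∑ s ∈ t, Pi.single s (g s)) =
      ∑ s ∈ t, g s • G.starVec s := by
    classical
    intro t
    induction t using Finset.induction_on with
    | empty => simp [coboundary_zero]
    | insert s t hs ih =>
      rw [Finset.sum_insert hs, Finset.sum_insert hs, coboundary_add, ih, ← coboundary_single]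
      congr 1
      ext e
      simp [coboundary, Pi.single_apply, mul_add]
  exact this _

theorem sum_mul_card_eq [Fintype E] {T : Type*} [DecidableEq T] (f : E × Bool → T) (t : T)
    (w : E → ZMod 2) :
    ∑ d with f d = t, w d.1 =
      ∑ e, ((Finset.univ.filter fun b : Bool => f (e, b) = t).card : ZMod 2) * w e := by
  rw [Finset.sum_filter, Fintype.sum_prod_type]
  refine Finset.sum_congr rfl fun e _ => ?_
  rw [Finset.card_filter]
  push_cast
  rw [Finset.sum_mul]
  simp

end SurfaceGraph

/-! ### Ground states of the toric code -/

/-! ### Powers of Pauli matrices as translations and signs. -/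

section Pauli

theorem sigmaX_pow_apply (k : ℕ) (a b : ZMod 2) :
    (sigmaX ^ k : Matrix (Fin 2) (Fin 2) ℂ) a b = if b = a + (k : ZMod 2) then 1 else 0 := by
  have h2 : sigmaX ^ 2 = 1 := by
    ext i j
    fin_cases i <;> fin_cases j <;> simp [sigmaX, pow_two]
  revert a b
  obtain ⟨m, rfl | rfl⟩ := Nat.even_or_odd' k
  · have hk : ((2 * m : ℕ) : ZMod 2) = 0 := by
      push_cast
      rw [show (2 : ZMod 2) = 0 from rfl, zero_mul]
    rw [pow_mul, h2, one_pow, hk]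
    refine Fin.forall_fin_two.2 ⟨Fin.forall_fin_two.2 ⟨?_, ?_⟩, Fin.forall_fin_two.2 ⟨?_, ?_⟩⟩
    · exact (Matrix.one_apply_eq 0).trans (if_pos (show (0 : ZMod 2) = 0 + 0 by decide)).symm
    · exact (Matrix.one_apply_ne (by decide)).trans (if_neg (show ¬ (1 : ZMod 2) = 0 + 0 by decide)).symm
    · exact (Matrix.one_apply_ne (by decide)).trans (if_neg (show ¬ (0 : ZMod 2) = 1 + 0 by decide)).symm
    · exact (Matrix.one_apply_eq 1).trans (if_pos (show (1 : ZMod 2) = 1 + 0 by decide)).symm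
  · have hk : ((2 * m + 1 : ℕ) : ZMod 2) = 1 := by
      push_cast
      rw [show (2 : ZMod 2) = 0 from rfl, zero_mul, zero_add]
    rw [pow_succ, pow_mul, h2, one_pow, one_mul, hk]
    refine Fin.forall_fin_two.2 ⟨Fin.forall_fin_two.2 ⟨?_, ?_⟩, Fin.forall_fin_two.2 ⟨?_, ?_⟩⟩
    · exact (show sigmaX 0 0 = 0 from rfl).trans (if_neg (show ¬ (0 : ZMod 2) = 0 + 1 by decide)).symm
    · exact (show sigmaX 0 1 = 1 from rfl).trans (if_pos (show (1 : ZMod 2) = 0 + 1 by decide)).symm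
    · exact (show sigmaX 1 0 = 1 from rfl).trans (if_pos (show (0 : ZMod 2) = 1 + 1 by decide)).symm
    · exact (show sigmaX 1 1 = 0 from rfl).trans (if_neg (show ¬ (1 : ZMod 2) = 1 + 1 by decide)).symm

theorem sigmaZ_pow_apply (k : ℕ) (a b : ZMod 2) :
    (sigmaZ ^ k : Matrix (Fin 2) (Fin 2) ℂ) a b = if a = b then (-1) ^ (k * a.val) else 0 := by
  have h : sigmaZ = Matrix.diagonal ![1, -1] := by
    ext i j
    fin_cases i <;> fin_cases j <;> rfl
  rw [h, Matrix.diagonal_pow]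
  revert a b
  refine Fin.forall_fin_two.2 ⟨Fin.forall_fin_two.2 ⟨?_, ?_⟩, Fin.forall_fin_two.2 ⟨?_, ?_⟩⟩
  · refine (Matrix.diagonal_apply_eq _ 0).trans (Eq.trans ?_ (if_pos rfl).symm)
    have : ZMod.val (n := 2) (0 : Fin 2) = 0 := rfl
    simp [this]
  · exact (Matrix.diagonal_apply_ne _ (by decide)).trans (if_neg (show ¬ (0 : ZMod 2) = 1 by decide)).symm
  · exact (Matrix.diagonal_apply_ne _ (by decide)).trans (if_neg (show ¬ (1 : ZMod 2) = 0 by decide)).symm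
  · refine (Matrix.diagonal_apply_eq _ 1).trans (Eq.trans ?_ (if_pos rfl).symm)
    have : ZMod.val (n := 2) (1 : Fin 2) = 1 := rfl
    simp [this]

variable {E : Type*} [Fintype E] [DecidableEq E]

theorem siteTensor_sigmaX_mulVec (k : E → ℕ) (ψ : (E → ZMod 2) → ℂ) (a : E → ZMod 2) :
    (siteTensor fun e => sigmaX ^ k e).mulVec ψ a = ψ (a + fun e => (k e : ZMod 2)) := by
  classical
  have : ∀ b : E → ZMod 2, siteTensor (fun e => sigmaX ^ k e) a b =
      if b = a + (fun e => (k e : ZMod 2)) then 1 else 0 := by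
    intro b
    refine (Finset.prod_congr rfl fun e _ => sigmaX_pow_apply (k e) (a e) (b e)).trans ?_
    rw [Finset.prod_ite_zero]
    simp [funext_iff]
  refine (Finset.sum_congr rfl fun b _ => congrArg (· * ψ b) (this b)).trans ?_
  refine (Finset.sum_eq_single (a + fun e => (k e : ZMod 2)) ?_ ?_).trans ?_
  · intro c _ hc
    simp [hc]
  · intro h
    exact absurd (Finset.mem_univ _) h
  · simp

theorem siteTensor_sigmaZ_mulVec (k : E → ℕ) (ψ : (E → ZMod 2) → ℂ) (a : E → ZMod 2) :
    (siteTensor fun e => sigmaZ ^ k e).mulVec ψ a =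
      (if ∑ e, (k e : ZMod 2) * a e = 0 then 1 else -1) * ψ a := by
  classical
  have : ∀ b : E → ZMod 2, siteTensor (fun e => sigmaZ ^ k e) a b =
      if a = b then (if ∑ e, (k e : ZMod 2) * a e = 0 then 1 else -1) else 0 := by
    intro b
    refine (Finset.prod_congr rfl fun e _ => sigmaZ_pow_apply (k e) (a e) (b e)).trans ?_
    rw [Finset.prod_ite_zero, Finset.prod_pow_eq_pow_sum]
    have h1 : ∑ e, (k e : ZMod 2) * a e = ((∑ e, k e * (a e).val : ℕ) : ZMod 2) := by
      push_cast
      simp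
    simp only [h1, ZMod.natCast_eq_zero_iff_even, Finset.mem_univ, true_imp_iff, funext_iff]
    by_cases hab : ∀ e, a e = b e
    · simp only [hab, implies_true, if_true]
      split_ifs with h
      · exact h.neg_one_pow
      · exact (Nat.not_even_iff_odd.1 h).neg_one_pow
    · simp only [hab, if_false]
  refine (Finset.sum_congr rfl fun b _ => congrArg (· * ψ b) (this b)).trans ?_
  refine (Finset.sum_eq_single a ?_ ?_).trans ?_
  · intro c _ hc
    simp [hc.symm]
  · intro h
    exact absurd (Finset.mem_univ _) h
  · simp

end Pauli

/-! ### Saturation of the energy bound. -/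

section GroundState

open SurfaceGraph

variable {E : Type*} [Fintype E] [DecidableEq E] (G : SurfaceGraph E)

theorem starOp_mulVec (s : G.Vertex) (ψ : (E → ZMod 2) → ℂ) (a : E → ZMod 2) :
    (G.starOp s).mulVec ψ a = ψ (a + G.starVec s) :=
  siteTensor_sigmaX_mulVec _ ψ a

open Classical in
theorem plaquetteOp_mulVec (p : G.Face) (ψ : (E → ZMod 2) → ℂ) (a : E → ZMod 2) :
    (G.plaquetteOp p).mulVec ψ a =
      (if ∑ d with G.faceOf d = p, a d.1 = 0 then 1 else -1) * ψ a := by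
  rw [sum_mul_card_eq]
  refine (siteTensor_sigmaZ_mulVec _ ψ a).trans ?_
  congr

theorem hamiltonian_mulVec (U J : ℝ) (ψ : (E → ZMod 2) → ℂ) (a : E → ZMod 2) :
    (G.hamiltonian U J).mulVec ψ a = -(U : ℂ) * ∑ s, (G.starOp s).mulVec ψ a -
      (J : ℂ) * ∑ p, (G.plaquetteOp p).mulVec ψ a := by
  have h : ∀ (ψ : (E → Fin 2) → ℂ) (a : E → Fin 2), (G.hamiltonian U J).mulVec ψ a =
      -(U : ℂ) * ∑ s, (G.starOp s).mulVec ψ a - (J : ℂ) * ∑ p, (G.plaquetteOp p).mulVec ψ a := by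
    intro ψ a
    simp only [hamiltonian, Matrix.sub_mulVec, Matrix.smul_mulVec, Matrix.sum_mulVec,
      Finset.sum_apply, Pi.sub_apply, Pi.smul_apply, smul_eq_mul]
  exact h ψ a

variable {G}

/-- The reference state: the uniform superposition of all contractible dual loops. -/
theorem exists_eigenvector (U J : ℝ) : ∃ φ : (E → ZMod 2) → ℂ, φ ≠ 0 ∧
    (G.hamiltonian U J).mulVec φ =
      ((-(U * Fintype.card G.Vertex + J * Fintype.card G.Face) : ℝ) : ℂ) • φ := by
  classical
  let φ : (E → ZMod 2) → ℂ := fun a => if a ∈ Set.range G.coboundary then 1 else 0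
  refine ⟨φ, fun h => ?_, ?_⟩
  · have := congrFun h 0
    simp only [φ, if_pos (show (0 : E → ZMod 2) ∈ Set.range G.coboundary from
      ⟨0, G.coboundary_zero⟩)] at this
    exact one_ne_zero this
  · have h1 : ∀ s a, φ (a + G.starVec s) = φ a := by
      intro s a
      have : a + G.starVec s ∈ Set.range G.coboundary ↔ a ∈ Set.range G.coboundary := by
        rw [← coboundary_single]
        constructor
        · rintro ⟨g, hg⟩
          refine ⟨g + Pi.single s 1, ?_⟩
          rw [coboundary_add, hg, add_assoc, ZModModule.add_self, add_zero]
        · rintro ⟨g, rfl⟩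
          exact ⟨g + Pi.single s 1, coboundary_add _ _ _⟩
      simp only [φ, this]
    have h2 : ∀ (p : G.Face) (a), (if ∑ d with G.faceOf d = p, a d.1 = 0 then 1 else -1) * φ a =
        φ a := by
      intro p a
      by_cases ha : a ∈ Set.range G.coboundary
      · obtain ⟨g, rfl⟩ := ha
        rw [if_pos (G.isDualLoop_coboundary g p), one_mul]
      · rw [show φ a = 0 from if_neg ha, mul_zero]
    refine funext fun a : E → ZMod 2 => ?_
    refine (hamiltonian_mulVec G U J φ a).trans ?_
    simp only [starOp_mulVec, plaquetteOp_mulVec, h1, h2, Finset.sum_const, Finset.card_univ,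
      nsmul_eq_mul]
    change _ = ((-(U * Fintype.card G.Vertex + J * Fintype.card G.Face) : ℝ) : ℂ) * φ a
    push_cast
    ring

/-- Ground states of the toric code are supported on dual loops and are invariant under translation
by contractible dual loops. -/
theorem groundState_support_and_invariance {U J : ℝ} (hU : 0 < U) (hJ : 0 < J)
    {ψ : (E → ZMod 2) → ℂ} (hψ : IsGroundState (G.hamiltonian U J) ψ) :
    (∀ a, ψ a ≠ 0 → G.IsDualLoop a) ∧ ∀ g a, ψ (a + G.coboundary g) = ψ a := by
  classical
  obtain ⟨hn, E₀, hE₀, hmin⟩ := hψ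
  obtain ⟨φ, hφ0, hφ⟩ := exists_eigenvector (G := G) U J
  have hle := hmin _ φ hφ0 hφ
  replace hn : ∑ a : E → ZMod 2, ‖ψ a‖ ^ 2 = 1 := hn
  have hpt : ∀ a : E → ZMod 2, (E₀ : ℂ) * ψ a = -(U : ℂ) * ∑ s, ψ (a + G.starVec s) -
      (J : ℂ) * ∑ p, (if ∑ d with G.faceOf d = p, a d.1 = 0 then 1 else -1) * ψ a := by
    intro a
    have := (hamiltonian_mulVec G U J ψ a).symm.trans (congrFun hE₀ a)
    simp only [starOp_mulVec, plaquetteOp_mulVec] at this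
    exact this.symm
  have hsum : ∀ s, ∑ a : E → ZMod 2, ‖ψ (a + G.starVec s)‖ ^ 2 = 1 := fun s =>
    (Equiv.sum_comp (Equiv.addRight (G.starVec s)) fun a => ‖ψ a‖ ^ 2).trans hn
  -- Since `A_s` is a permutation of the basis, `‖A_s ψ - ψ‖² = 2 - 2 Re ⟨ψ, A_s ψ⟩`.
  have hstar : ∀ s, ∑ a : E → ZMod 2, (starRingEnd ℂ (ψ a) * ψ (a + G.starVec s)).re =
      1 - (∑ a : E → ZMod 2, ‖ψ (a + G.starVec s) - ψ a‖ ^ 2) / 2 := by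
    intro s
    have : ∀ a, ‖ψ (a + G.starVec s) - ψ a‖ ^ 2 = ‖ψ (a + G.starVec s)‖ ^ 2 + ‖ψ a‖ ^ 2 -
        2 * (starRingEnd ℂ (ψ a) * ψ (a + G.starVec s)).re := by
      intro a
      simp only [← Complex.normSq_eq_norm_sq, Complex.normSq_apply, Complex.sub_re, Complex.sub_im,
        Complex.mul_re, Complex.conj_re, Complex.conj_im]
      ring
    simp only [this, Finset.sum_sub_distrib, Finset.sum_add_distrib, hsum, hn, ← Finset.mul_sum]
    ring
  have hplaq : ∀ p : G.Face, ∑ a : E → ZMod 2, (starRingEnd ℂ (ψ a) *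
      ((if ∑ d with G.faceOf d = p, a d.1 = 0 then 1 else -1) * ψ a)).re =
      1 - 2 * ∑ a : E → ZMod 2, if ∑ d with G.faceOf d = p, a d.1 = 0 then 0 else ‖ψ a‖ ^ 2 := by
    intro p
    rw [← hn, Finset.mul_sum, ← Finset.sum_sub_distrib]
    refine Finset.sum_congr rfl fun a _ => ?_
    simp only [← Complex.normSq_eq_norm_sq, Complex.normSq_apply]
    split_ifs
    · simp
    · simp
      ring
  -- The eigenvalue equation paired with `ψ`: every term contributes its extreme value up to a
  -- nonnegative deficit.
  have henergy : E₀ = -U * ∑ s, (1 - (∑ a : E → ZMod 2, ‖ψ (a + G.starVec s) - ψ a‖ ^ 2) / 2) -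
      J * ∑ p : G.Face, (1 - 2 * ∑ a : E → ZMod 2,
        if ∑ d with G.faceOf d = p, a d.1 = 0 then 0 else ‖ψ a‖ ^ 2) := by
    simp only [← hstar, ← hplaq]
    rw [Finset.sum_comm, Finset.sum_comm (s := (Finset.univ : Finset G.Face)), Finset.mul_sum,
      Finset.mul_sum, ← Finset.sum_sub_distrib]
    have : E₀ = ∑ a : E → ZMod 2, E₀ * ‖ψ a‖ ^ 2 := by rw [← Finset.mul_sum, hn, mul_one]
    refine this.trans (Finset.sum_congr rfl fun a _ => ?_)
    have h := congrArg (fun z => (starRingEnd ℂ (ψ a) * z).re) (hpt a)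
    simp only [mul_sub, Complex.sub_re] at h
    have e1 : (starRingEnd ℂ (ψ a) * ((E₀ : ℂ) * ψ a)).re = E₀ * ‖ψ a‖ ^ 2 := by
      rw [mul_left_comm, Complex.re_ofReal_mul, mul_comm (starRingEnd ℂ (ψ a)), Complex.mul_conj,
        Complex.normSq_eq_norm_sq, Complex.ofReal_re]
    rw [← e1, h, mul_left_comm, mul_left_comm _ (J : ℂ), ← Complex.ofReal_neg,
      Complex.re_ofReal_mul, Complex.re_ofReal_mul, Finset.mul_sum, Finset.mul_sum,
      Complex.re_sum, Complex.re_sum]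
  -- By `hle` the energy is at most that of the reference state, which has no deficit; so all
  -- deficits vanish.
  have h0 : U * ∑ s, (∑ a : E → ZMod 2, ‖ψ (a + G.starVec s) - ψ a‖ ^ 2) / 2 +
      J * ∑ p : G.Face, 2 * ∑ a : E → ZMod 2,
        (if ∑ d with G.faceOf d = p, a d.1 = 0 then 0 else ‖ψ a‖ ^ 2) ≤ 0 := by
    simp only [Finset.sum_sub_distrib, Finset.sum_const, Finset.card_univ, nsmul_eq_mul,
      mul_one] at henergy
    linarith
  have hite : ∀ (p : G.Face) (a : E → ZMod 2),
      0 ≤ (if ∑ d with G.faceOf d = p, a d.1 = 0 then 0 else ‖ψ a‖ ^ 2) := by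
    intro p a
    split_ifs
    · exact le_rfl
    · positivity
  have n1 : 0 ≤ ∑ s, (∑ a : E → ZMod 2, ‖ψ (a + G.starVec s) - ψ a‖ ^ 2) / 2 := by positivity
  have n2 : 0 ≤ ∑ p : G.Face, 2 * ∑ a : E → ZMod 2,
      (if ∑ d with G.faceOf d = p, a d.1 = 0 then 0 else ‖ψ a‖ ^ 2) :=
    Finset.sum_nonneg fun p _ => mul_nonneg zero_le_two (Finset.sum_nonneg fun a _ => hite p a)
  have z1 : ∑ s, (∑ a : E → ZMod 2, ‖ψ (a + G.starVec s) - ψ a‖ ^ 2) / 2 = 0 := by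
    by_contra h
    have := mul_pos hU (lt_of_le_of_ne n1 (Ne.symm h))
    have := mul_nonneg hJ.le n2
    linarith
  have z2 : ∑ p : G.Face, 2 * ∑ a : E → ZMod 2,
      (if ∑ d with G.faceOf d = p, a d.1 = 0 then 0 else ‖ψ a‖ ^ 2) = 0 := by
    by_contra h
    have := mul_pos hJ (lt_of_le_of_ne n2 (Ne.symm h))
    have := mul_nonneg hU.le n1
    linarith
  constructor
  · intro a ha p
    by_contra hp
    have := (Finset.sum_eq_zero_iff_of_nonneg fun p _ => mul_nonneg zero_le_two
      (Finset.sum_nonneg fun a _ => hite p a)).1 z2 p (Finset.mem_univ _)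
    have := (Finset.sum_eq_zero_iff_of_nonneg fun a _ => hite p a).1
      (by linarith) a (Finset.mem_univ _)
    rw [if_neg] at this
    · exact ha (by simpa using this)
    · convert hp
  · have hs : ∀ s a, ψ (a + G.starVec s) = ψ a := by
      intro s a
      have := (Finset.sum_eq_zero_iff_of_nonneg fun s _ => by positivity).1 z1 s (Finset.mem_univ _)
      have := (Finset.sum_eq_zero_iff_of_nonneg fun a _ => by positivity).1
        (show ∑ a : E → ZMod 2, ‖ψ (a + G.starVec s) - ψ a‖ ^ 2 = 0 by linarith) a
        (Finset.mem_univ _)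
      exact sub_eq_zero.1 (by simpa using this)
    intro g a
    rw [coboundary_eq_sum]
    induction (Finset.univ : Finset G.Vertex) using Finset.induction_on generalizing a with
    | empty => simp
    | insert s t hst ih =>
      rw [Finset.sum_insert hst, ← add_assoc, ih]
      have : ∀ x : ZMod 2, x = 0 ∨ x = 1 := by decide
      rcases this (g s) with h | h
      · simp [h]
      · rw [h, one_smul, hs]

end GroundState
end ToricCode

namespace ToricCode

/-! ### Homology modulo 2 -/

section Differential

variable {E T : Type*}

/-- The differential of a function on the classes of darts given by `t`. -/
def differential (t : E × Bool → T) : (T → ZMod 2) →ₗ[ZMod 2] (E → ZMod 2) where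
  toFun f e := f (t (e, false)) + f (t (e, true))
  map_add' f g := by
    ext e
    simp only [Pi.add_apply]
    ring
  map_smul' c f := by
    ext e
    simp [mul_add]

theorem differential_apply_fst (t : E × Bool → T) (f : T → ZMod 2) (d : E × Bool) :
    differential t f d.1 = f (t d) + f (t (SurfaceGraph.flip d)) := by
  obtain ⟨e, b⟩ := d
  cases b <;> simp [differential, SurfaceGraph.flip, add_comm]

variable [Fintype E]

theorem differential_dotProduct [Fintype T] [DecidableEq T] (t : E × Bool → T) (f : T → ZMod 2)
    (w : E → ZMod 2) : differential t f ⬝ᵥ w = ∑ p, f p * ∑ d with t d = p, w d.1 := by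
  have : ∀ p, f p * ∑ d with t d = p, w d.1 =
      ∑ d : E × Bool, if t d = p then f p * w d.1 else 0 := by
    intro p
    rw [Finset.sum_filter, Finset.mul_sum]
    simp
  simp only [this]
  rw [Finset.sum_comm, Fintype.sum_prod_type]
  simp only [Finset.sum_ite_eq, Finset.mem_univ, if_true, dotProduct, differential,
    LinearMap.coe_mk, AddHom.coe_mk]
  refine Finset.sum_congr rfl fun e _ => ?_
  simp only [Fintype.univ_bool]
  rw [Finset.sum_pair (by decide)]
  ring

-- One dimension is lost because, by `hconst`, the kernel consists of the constants.
omit [Fintype E] in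
theorem finrank_range_differential [Finite T] [Nonempty T] (t : E × Bool → T)
    (hconst : ∀ f : T → ZMod 2, (∀ d, f (t d) = f (t (SurfaceGraph.flip d))) → ∀ p q, f p = f q) :
    Module.finrank (ZMod 2) (LinearMap.range (differential t)) + 1 = Nat.card T := by
  classical
  have : Fintype T := Fintype.ofFinite T
  have hker : LinearMap.ker (differential t) = Submodule.span (ZMod 2) {fun _ => 1} := by
    ext f
    rw [LinearMap.mem_ker, Submodule.mem_span_singleton]
    constructor
    · intro hf
      refine ⟨f (Classical.arbitrary T), ?_⟩
      ext p
      rw [Pi.smul_apply, smul_eq_mul, mul_one]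
      refine hconst f (fun d => ?_) _ _
      have := congrFun hf d.1
      rw [differential_apply_fst] at this
      exact CharTwo.add_eq_zero.1 this
    · rintro ⟨c, rfl⟩
      ext e
      simp [differential, CharTwo.add_self_eq_zero]
  have h := LinearMap.finrank_range_add_finrank_ker (differential t)
  rw [hker, finrank_span_singleton, Module.finrank_fintype_fun_eq_card] at h
  · rw [h, Nat.card_eq_fintype_card]
  · intro h0
    exact one_ne_zero (congrFun h0 (Classical.arbitrary T))

/-- The dot product as a bilinear form on `E → ZMod 2`. -/
def dotForm (E : Type*) [Fintype E] : LinearMap.BilinForm (ZMod 2) (E → ZMod 2) :=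
  dotProductBilin (ZMod 2) (ZMod 2)

theorem dotForm_apply (v w : E → ZMod 2) : dotForm E v w = v ⬝ᵥ w := rfl

theorem dotForm_isRefl : (dotForm E).IsRefl := fun v w h => by
  rw [dotForm_apply, dotProduct_comm]
  exact h

theorem dotForm_nondegenerate : (dotForm E).Nondegenerate := by
  classical
  constructor
  · intro v h
    ext e
    simpa [dotForm_apply] using h (Pi.single e 1)
  · intro v h
    ext e
    simpa [dotForm_apply] using h (Pi.single e 1)

theorem mem_orthogonal_range_differential [Fintype T] [DecidableEq T] (t : E × Bool → T)
    (w : E → ZMod 2) : w ∈ (dotForm E).orthogonal (LinearMap.range (differential t)) ↔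
      ∀ p, ∑ d with t d = p, w d.1 = 0 := by
  rw [LinearMap.BilinForm.mem_orthogonal_iff]
  constructor
  · intro h p
    have := h _ ⟨Pi.single p 1, rfl⟩
    rw [dotForm_apply, differential_dotProduct] at this
    simpa [Pi.single_apply] using this
  · rintro h _ ⟨f, rfl⟩
    rw [dotForm_apply, differential_dotProduct]
    simp [h]

end Differential

/-! ### Dual loops modulo contractible ones. -/

namespace SurfaceGraph

variable {E : Type*} {G : SurfaceGraph E}

theorem const_of_rot_of_flip {M : Type*} {F : E × Bool → M} (h1 : ∀ d, F (G.rot d) = F d)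
    (h2 : ∀ d, F (flip d) = F d) (d d' : E × Bool) : F d = F d' := by
  induction G.connected d d' with
  | refl => rfl
  | tail _ h ih =>
    rcases h with rfl | rfl
    · rw [h1, ih]
    · exact ih.trans (h2 _).symm

theorem vertexFun_const {g : G.Vertex → ZMod 2}
    (h : ∀ d, g (G.vertexOf d) = g (G.vertexOf (flip d))) (s s' : G.Vertex) : g s = g s' := by
  obtain ⟨d, rfl⟩ := Quotient.exists_rep s
  obtain ⟨d', rfl⟩ := Quotient.exists_rep s'
  exact const_of_rot_of_flip (F := fun d => g (G.vertexOf d))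
    (fun d => by rw [vertexOf_rot]) (fun d => (h d).symm) d d'

theorem faceFun_const {f : G.Face → ZMod 2}
    (h : ∀ d, f (G.faceOf d) = f (G.faceOf (flip d))) (p p' : G.Face) : f p = f p' := by
  obtain ⟨d, rfl⟩ := Quotient.exists_rep p
  obtain ⟨d', rfl⟩ := Quotient.exists_rep p'
  exact const_of_rot_of_flip (F := fun d => f (G.faceOf d))
    (fun d => by rw [h, faceOf_flip_rot]) (fun d => (h d).symm) d d'

variable (G) in
/-- The space of dual loops. -/
def dualLoops [Fintype E] : Submodule (ZMod 2) (E → ZMod 2) :=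
  (dotForm E).orthogonal (LinearMap.range (differential G.faceOf))

variable (G) in
/-- The space of contractible dual loops. -/
def contractibleDualLoops : Submodule (ZMod 2) (E → ZMod 2) :=
  LinearMap.range (differential G.vertexOf)

theorem mem_dualLoops [Fintype E] {w : E → ZMod 2} : w ∈ G.dualLoops ↔ G.IsDualLoop w :=
  mem_orthogonal_range_differential _ _

theorem mem_contractibleDualLoops {w : E → ZMod 2} :
    w ∈ G.contractibleDualLoops ↔ G.IsContractibleDualLoop w := by
  simp [contractibleDualLoops, IsContractibleDualLoop, differential, funext_iff, eq_comm]

theorem mem_contractibleDualLoops_iff_coboundary {w : E → ZMod 2} :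
    w ∈ G.contractibleDualLoops ↔ ∃ g, w = G.coboundary g := by
  simp [mem_contractibleDualLoops, IsContractibleDualLoop, coboundary, funext_iff]

variable [Fintype E]

theorem contractibleDualLoops_le : G.contractibleDualLoops ≤ G.dualLoops := by
  rintro w hw
  obtain ⟨g, rfl⟩ := mem_contractibleDualLoops_iff_coboundary.1 hw
  exact mem_dualLoops.2 (G.isDualLoop_coboundary g)

theorem IsLoop.dotProduct_eq_zero {z w : E → ZMod 2} (hz : G.IsLoop z)
    (hw : w ∈ G.contractibleDualLoops) : z ⬝ᵥ w = 0 := by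
  rw [dotProduct_comm]
  exact (mem_orthogonal_range_differential G.vertexOf z).2 hz w hw

/-- Non-contractible loops are detected by dual loops. -/
theorem exists_dotProduct_ne_zero {z : E → ZMod 2} (hz : ¬ G.IsContractibleLoop z) :
    ∃ w ∈ G.dualLoops, z ⬝ᵥ w ≠ 0 := by
  by_contra! h
  refine hz ?_
  have : z ∈ (dotForm E).orthogonal G.dualLoops := by
    intro w hw
    rw [dotForm_isRefl.eq_iff]
    exact h w hw
  -- Dual loops are the orthogonal complement of the boundaries, so taking complements twice returns
  -- the boundaries.
  rw [dualLoops, LinearMap.BilinForm.orthogonal_orthogonal dotForm_nondegenerate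
    dotForm_isRefl] at this
  obtain ⟨f, rfl⟩ := this
  exact ⟨f, fun e => rfl⟩

/-- The dimensions are `|E| - (|F| - 1)` and `|V| - 1`, whose difference is two minus the Euler
characteristic. -/
theorem IsTorus.finrank_dualLoops (hG : G.IsTorus) : Module.finrank (ZMod 2) G.dualLoops =
    Module.finrank (ZMod 2) G.contractibleDualLoops + 2 := by
  obtain ⟨e⟩ := G.nonempty
  have : Nonempty G.Vertex := ⟨G.vertexOf (e, false)⟩
  have : Nonempty G.Face := ⟨G.faceOf (e, false)⟩
  have hV := finrank_range_differential G.vertexOf fun g => vertexFun_const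
  have hF := finrank_range_differential G.faceOf fun f => faceFun_const
  have hle := Submodule.finrank_le (LinearMap.range (differential G.faceOf))
  rw [dualLoops, LinearMap.BilinForm.finrank_orthogonal dotForm_nondegenerate,
    contractibleDualLoops]
  rw [Module.finrank_fintype_fun_eq_card] at hle ⊢
  rw [Nat.card_eq_fintype_card] at hV hF
  unfold IsTorus at hG
  omega

/-- On the torus, the dual loops which do not meet a given non-contractible loop (modulo 2) form at
most two classes. -/
theorem IsTorus.add_mem_contractibleDualLoops (hG : G.IsTorus) {z w w' : E → ZMod 2}
    (hz : G.IsLoop z) (hz' : ¬ G.IsContractibleLoop z)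
    (hw : w ∈ G.dualLoops) (hw' : w' ∈ G.dualLoops) (hzw : z ⬝ᵥ w = 0) (hzw' : z ⬝ᵥ w' = 0)
    (hwS : w ∉ G.contractibleDualLoops) (hwS' : w' ∉ G.contractibleDualLoops) :
    w + w' ∈ G.contractibleDualLoops := by
  obtain ⟨u, hu, hzu⟩ := exists_dotProduct_ne_zero hz'
  -- `contractibleDualLoops < contractibleDualLoops ⊔ span {w} ≤ L < dualLoops` with codimension two
  -- overall, so the middle inclusion is an equality.
  let L : Submodule (ZMod 2) (E → ZMod 2) := G.dualLoops ⊓ LinearMap.ker (dotForm E z)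
  have hL : Module.finrank (ZMod 2) L < Module.finrank (ZMod 2) G.dualLoops := by
    refine Submodule.finrank_lt_finrank_of_lt (lt_of_le_of_ne inf_le_left fun h => hzu ?_)
    have : u ∈ L := h.symm ▸ hu
    exact this.2
  have hSw : Module.finrank (ZMod 2) G.contractibleDualLoops < Module.finrank (ZMod 2)
      (G.contractibleDualLoops ⊔ Submodule.span (ZMod 2) {w} : Submodule _ _) := by
    refine Submodule.finrank_lt_finrank_of_lt (lt_of_le_of_ne le_sup_left fun h => hwS ?_)
    rw [h]
    exact Submodule.mem_sup_right (Submodule.mem_span_singleton_self w)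
  have hle : G.contractibleDualLoops ⊔ Submodule.span (ZMod 2) {w} ≤ L := by
    refine sup_le (fun x hx => ⟨contractibleDualLoops_le hx, hz.dotProduct_eq_zero hx⟩) ?_
    rw [Submodule.span_singleton_le_iff_mem]
    exact ⟨hw, hzw⟩
  have heq := Submodule.eq_of_le_of_finrank_le hle (by
    have := hG.finrank_dualLoops
    omega)
  have hwL : w' ∈ L := ⟨hw', hzw'⟩
  rw [← heq, Submodule.mem_sup] at hwL
  obtain ⟨y, hy, x, hx, rfl⟩ := hwL
  obtain ⟨c, rfl⟩ := Submodule.mem_span_singleton.1 hx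
  have : ∀ c : ZMod 2, c = 0 ∨ c = 1 := by decide
  rcases this c with rfl | rfl
  · exact absurd (by simpa using hy) hwS'
  · rw [one_smul, add_comm y, ← add_assoc, ZModModule.add_self, zero_add]
    exact hy

/-- On the torus, a dual loop which avoids a non-contractible region `X` is equivalent to a dual
loop supported in any other non-contractible region `Y`. -/
theorem IsTorus.exists_add_mem_contractibleDualLoops (hG : G.IsTorus) {X Y : Set E}
    (hX : G.NonContractible X) (hY : G.NonContractible Y) (hXY : Disjoint X Y) {w : E → ZMod 2}
    (hw : w ∈ G.dualLoops) (hwX : ∀ e ∈ X, w e = 0) :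
    ∃ w' ∈ G.dualLoops, (∀ e ∉ Y, w' e = 0) ∧ w + w' ∈ G.contractibleDualLoops := by
  by_cases hwS : w ∈ G.contractibleDualLoops
  · exact ⟨0, zero_mem _, fun _ _ => rfl, by simpa using hwS⟩
  obtain ⟨⟨z, hz, hzX, hz'⟩, -⟩ := hX
  obtain ⟨-, ⟨w', hw', hwY, hwS'⟩⟩ := hY
  have hwY' : ∀ e ∉ Y, w' e = 0 := fun e he => by_contra fun h => he (hwY e h)
  refine ⟨w', mem_dualLoops.2 hw', hwY', hG.add_mem_contractibleDualLoops hz hz' hw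
    (mem_dualLoops.2 hw') ?_ ?_ hwS (mt mem_contractibleDualLoops.1 hwS')⟩
  · refine Finset.sum_eq_zero fun e _ => ?_
    by_cases h : z e = 0
    · simp [h]
    · simp [hwX e (hzX e h)]
  · refine Finset.sum_eq_zero fun e _ => ?_
    by_cases h : z e = 0
    · simp [h]
    · simp [hwY' e (Set.disjoint_left.1 hXY (hzX e h))]

end SurfaceGraph
end ToricCode

namespace ToricCode

/-! ### Assembling configurations of the regions -/

section Assemble

variable {E : Type*} (r : E → Region)

/-- Bit configurations on `A = A₁ ∪ A₂`. -/
abbrev BitsA : Type _ := {e // r e = .A₁ ∨ r e = .A₂} → ZMod 2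

/-- Bit configurations on a single region. -/
abbrev BitsOf (X : Region) : Type _ := {e // r e = X} → ZMod 2

/-- The map `glue`, with bits as elements of `ZMod 2`. -/
def assemble (x : BitsA r × BitsOf r .B₁ × BitsOf r .B₂) : E → ZMod 2 :=
  glue r x.1 x.2.1 x.2.2

variable {r}

theorem assemble_A (x : BitsA r × BitsOf r .B₁ × BitsOf r .B₂) {e : E}
    (h : r e = .A₁ ∨ r e = .A₂) : assemble r x e = x.1 ⟨e, h⟩ := by
  unfold assemble glue
  split
  all_goals first
    | rfl
    | (rename_i h'
       rw [h'] at h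
       simp at h)

theorem assemble_B₁ (x : BitsA r × BitsOf r .B₁ × BitsOf r .B₂) {e : E} (h : r e = .B₁) :
    assemble r x e = x.2.1 ⟨e, h⟩ := by
  unfold assemble glue
  split
  all_goals first
    | rfl
    | (rename_i h'
       rw [h'] at h
       simp at h)

theorem assemble_B₂ (x : BitsA r × BitsOf r .B₁ × BitsOf r .B₂) {e : E} (h : r e = .B₂) :
    assemble r x e = x.2.2 ⟨e, h⟩ := by
  unfold assemble glue
  split
  all_goals first
    | rfl
    | (rename_i h'
       rw [h'] at h
       simp at h)

theorem Region.cases_A (X : Region) : (X = .A₁ ∨ X = .A₂) ∨ X = .B₁ ∨ X = .B₂ := by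
  cases X <;> simp

theorem assemble_add (x y : BitsA r × BitsOf r .B₁ × BitsOf r .B₂) :
    assemble r (x + y) = assemble r x + assemble r y := by
  ext e
  rcases (r e).cases_A with h | h | h
  · simp [assemble_A _ h]
  · simp [assemble_B₁ _ h]
  · simp [assemble_B₂ _ h]

variable (r) in
/-- Assembling configurations of `A`, `B₁` and `B₂` is an isomorphism. -/
def assembleEquiv : (BitsA r × BitsOf r .B₁ × BitsOf r .B₂) ≃+ (E → ZMod 2) where
  toFun := assemble r
  invFun w := (fun e => w e, fun e => w e, fun e => w e)
  left_inv x := by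
    ext e
    · exact assemble_A x e.2
    · exact assemble_B₁ x e.2
    · exact assemble_B₂ x e.2
  right_inv w := by
    ext e
    rcases (r e).cases_A with h | h | h
    · rw [assemble_A _ h]
    · rw [assemble_B₁ _ h]
    · rw [assemble_B₂ _ h]
  map_add' := assemble_add

theorem assembleEquiv_apply (x : BitsA r × BitsOf r .B₁ × BitsOf r .B₂) :
    assembleEquiv r x = assemble r x := rfl

variable (r)

/-- A space of configurations, in terms of the configurations of `A`, `B₁` and `B₂`. -/
def regionwise (W : Submodule (ZMod 2) (E → ZMod 2)) :
    AddSubgroup (BitsA r × BitsOf r .B₁ × BitsOf r .B₂) :=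
  W.toAddSubgroup.comap (assembleEquiv r).toAddMonoidHom

variable {r}

theorem mem_regionwise {W : Submodule (ZMod 2) (E → ZMod 2)}
    {x : BitsA r × BitsOf r .B₁ × BitsOf r .B₂} :
    x ∈ regionwise r W ↔ assemble r x ∈ W := Iff.rfl

end Assemble

/-! ### The homological conditions for the refined partition -/

namespace SurfaceGraph

variable {E : Type*} {G : SurfaceGraph E} {r : E → Region} [Fintype E]

theorem IsRefinedPartition.exists_shift (hr : G.IsRefinedPartition r) (hG : G.IsTorus)
    {X Y : Region} (hXY : X ≠ Y) {w : E → ZMod 2} (hw : w ∈ G.dualLoops)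
    (hwX : ∀ e, r e = X → w e = 0) : ∃ w' ∈ G.dualLoops, (∀ e, r e ≠ Y → w' e = 0) ∧
      w + w' ∈ G.contractibleDualLoops :=
  hG.exists_add_mem_contractibleDualLoops (hr.nonContractible X) (hr.nonContractible Y)
    (Set.disjoint_left.2 fun _ h h' => hXY (h.symm.trans h')) hw hwX

/-- The loop avoids `A₁`, so its class can be cancelled inside `B₂` without touching `b`. -/
theorem IsRefinedPartition.exists_shift_B₂ (hr : G.IsRefinedPartition r) (hG : G.IsTorus)
    (b : BitsOf r .B₁) (c : BitsOf r .B₂)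
    (h : ((0 : BitsA r), b, c) ∈ regionwise r G.dualLoops) :
    ∃ c', ((0 : BitsA r), b, c') ∈ regionwise r G.contractibleDualLoops := by
  obtain ⟨w, -, hwY, hw⟩ := hr.exists_shift hG (X := .A₁) (Y := .B₂) (by decide)
    (mem_regionwise.1 h) fun e he => assemble_A _ (Or.inl he)
  refine ⟨fun e => c e + w e, ?_⟩
  rw [mem_regionwise]
  convert hw using 1
  ext e
  rcases (r e).cases_A with h | h | h
  · rw [Pi.add_apply, assemble_A _ h, assemble_A _ h, hwY e (by rcases h with h | h <;> simp [h])]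
    simp
  · rw [Pi.add_apply, assemble_B₁ _ h, assemble_B₁ _ h, hwY e (by simp [h]), add_zero]
  · rw [Pi.add_apply, assemble_B₂ _ h, assemble_B₂ _ h]

/-- The loop avoids `B₂`, so its class can be cancelled inside `A₁`. -/
theorem IsRefinedPartition.exists_shift_A (hr : G.IsRefinedPartition r) (hG : G.IsTorus)
    (a : BitsA r) (b : BitsOf r .B₁)
    (h : (a, b, (0 : BitsOf r .B₂)) ∈ regionwise r G.dualLoops) :
    ∃ a', (a', b, (0 : BitsOf r .B₂)) ∈ regionwise r G.contractibleDualLoops := by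
  obtain ⟨w, -, hwY, hw⟩ := hr.exists_shift hG (X := .B₂) (Y := .A₁) (by decide)
    (mem_regionwise.1 h) fun e he => assemble_B₂ _ he
  refine ⟨fun e => a e + w e, ?_⟩
  rw [mem_regionwise]
  convert hw using 1
  ext e
  rcases (r e).cases_A with h | h | h
  · rw [Pi.add_apply, assemble_A _ h, assemble_A _ h]
  · rw [Pi.add_apply, assemble_B₁ _ h, assemble_B₁ _ h, hwY e (by simp [h]), add_zero]
  · rw [Pi.add_apply, assemble_B₂ _ h, assemble_B₂ _ h, hwY e (by simp [h]), add_zero]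

/-- The avoided region and the correcting region must differ, and the loop is only known to avoid
`B₂`. Its class is therefore first moved into `A₁`; the representative there avoids `A₂` and can be
moved on into `B₂`. -/
theorem IsRefinedPartition.exists_completion (hr : G.IsRefinedPartition r) (hG : G.IsTorus)
    (a : BitsA r) (b : BitsOf r .B₁)
    (h : (a, b, (0 : BitsOf r .B₂)) ∈ regionwise r G.dualLoops) :
    ∃ c, (a, b, c) ∈ regionwise r G.contractibleDualLoops := by
  obtain ⟨w, hwZ, hwY, hw⟩ := hr.exists_shift hG (X := .B₂) (Y := .A₁) (by decide)
    (mem_regionwise.1 h) fun e he => assemble_B₂ _ he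
  obtain ⟨u, -, huY, hu⟩ := hr.exists_shift hG (X := .A₂) (Y := .B₂) (by decide)
    hwZ fun e he => hwY e (by simp [he])
  refine ⟨fun e => u e, ?_⟩
  rw [mem_regionwise]
  convert add_mem hw hu using 1
  rw [add_assoc, ← add_assoc w, ZModModule.add_self, zero_add]
  ext e
  rcases (r e).cases_A with h | h | h
  · rw [Pi.add_apply, assemble_A _ h, assemble_A _ h, huY e (by rcases h with h | h <;> simp [h]),
      add_zero]
  · rw [Pi.add_apply, assemble_B₁ _ h, assemble_B₁ _ h, huY e (by simp [h]), add_zero]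
  · rw [Pi.add_apply, assemble_B₂ _ h, assemble_B₂ _ h]
    simp

/-! ### Counting along the border -/

/-- The faces which are incident with `A₂` and with `B₁`. -/
abbrev SpanningFace (G : SurfaceGraph E) (r : E → Region) : Type _ :=
  {p : G.Face // G.PlaquetteTouches r p .A₂ ∧ G.PlaquetteTouches r p .B₁}

theorem IsRefinedPartition.region_of_spanning_face (hr : G.IsRefinedPartition r)
    (p : SpanningFace G r) {d : E × Bool} (hd : G.faceOf d = p.1) :
    r d.1 = .A₂ ∨ r d.1 = .B₁ := by
  rcases h : r d.1 with _ | _ | _ | _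
  · exact absurd ⟨⟨d, hd, h⟩, p.2.2⟩ (hr.noBorder_A₁B₁.2 p.1)
  · exact Or.inl rfl
  · exact Or.inr rfl
  · exact absurd ⟨p.2.1, ⟨d, hd, h⟩⟩ (hr.noBorder_A₂B₂.2 p.1)

/-- The indicator of `B₁`. -/
def indicatorB₁ (r : E → Region) (e : E) : ZMod 2 := if r e = .B₁ then 1 else 0

open Classical in
theorem IsRefinedPartition.indicator_add (hr : G.IsRefinedPartition r) (p : SpanningFace G r)
    {d : E × Bool} (hd : G.faceOf d = p.1) :
    indicatorB₁ r d.1 + indicatorB₁ r (G.rot d).1 =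
      if d ∈ G.border r .A₂ .B₁ then 1 else 0 := by
  have h1 := hr.region_of_spanning_face p hd
  have h2 := hr.region_of_spanning_face p ((G.faceOf_flip_rot d).trans hd)
  change r (G.rot d).1 = .A₂ ∨ r (G.rot d).1 = .B₁ at h2
  rcases h1 with h1 | h1 <;> rcases h2 with h2 | h2 <;>
    simp [indicatorB₁, border, h1, h2, CharTwo.add_self_eq_zero]

omit [Fintype E] in
theorem faceOf_border_spanning {d : E × Bool} (hd : d ∈ G.border r .A₂ .B₁) :
    G.PlaquetteTouches r (G.faceOf d) .A₂ ∧ G.PlaquetteTouches r (G.faceOf d) .B₁ := by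
  rcases hd with ⟨h1, h2⟩ | ⟨h1, h2⟩
  · exact ⟨⟨d, rfl, h1⟩, ⟨flip (G.rot d), G.faceOf_flip_rot d, h2⟩⟩
  · exact ⟨⟨flip (G.rot d), G.faceOf_flip_rot d, h2⟩, ⟨d, rfl, h1⟩⟩

/-- Walking around the face from an `A₂` dart without crossing the border, one would never reach its
`B₁` dart. -/
theorem IsRefinedPartition.exists_border_of_spanning (hr : G.IsRefinedPartition r)
    (p : SpanningFace G r) : ∃ d ∈ G.border r .A₂ .B₁, G.faceOf d = p.1 := by
  obtain ⟨⟨d, hd, hdA⟩, ⟨d', hd', hdB⟩⟩ := p.2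
  by_contra! h
  have step : ∀ x : E × Bool, G.faceOf x = p.1 → r x.1 = .A₂ → r (G.facePerm x).1 = .A₂ := by
    intro x hx hxA
    have hfx : G.faceOf (G.facePerm x) = p.1 := (G.faceOf_facePerm x).trans hx
    rcases hr.region_of_spanning_face p hfx with h' | h'
    · exact h'
    · refine absurd hfx (h _ (Or.inr ⟨h', ?_⟩))
      rw [rot_facePerm]
      exact hxA
  have hpow : ∀ n : ℕ, G.faceOf ((G.facePerm ^ n) d) = p.1 ∧ r ((G.facePerm ^ n) d).1 = .A₂ := by
    intro n
    induction n with
    | zero => exact ⟨hd, hdA⟩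
    | succ n ih =>
      rw [pow_succ', Equiv.Perm.mul_apply]
      exact ⟨(G.faceOf_facePerm _).trans ih.1, step _ ih.1 ih.2⟩
  have hsame : G.facePerm.SameCycle d d' := Quotient.exact (hd.trans hd'.symm)
  obtain ⟨n, -, hn⟩ := hsame.exists_pow_eq'
  have := (hpow n).2
  rw [hn, hdB] at this
  exact absurd this (by decide)

theorem IsRefinedPartition.region_of_border_vertex (hr : G.IsRefinedPartition r)
    {d d' : E × Bool} (hd : d ∈ G.border r .A₂ .B₁) (h : G.vertexOf d' = G.vertexOf d) :
    r d'.1 ≠ .B₂ := by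
  intro hB
  refine hr.noBorder_A₂B₂.1 (G.vertexOf d) ⟨?_, d', h, hB⟩
  rcases hd with ⟨h1, -⟩ | ⟨-, h2⟩
  · exact ⟨d, rfl, h1⟩
  · exact ⟨G.rot d, G.vertexOf_rot d, h2⟩

open Classical in
/-- The boundary, at the faces between `A₂` and `B₁`, of the part in `B₁` of a configuration. -/
noncomputable def borderSum (G : SurfaceGraph E) (r : E → Region) :
    (E → ZMod 2) →+ (SpanningFace G r → ZMod 2) where
  toFun w p := ∑ d with G.faceOf d = p.1, indicatorB₁ r d.1 * w d.1
  map_zero' := by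
    ext p
    simp
  map_add' w w' := by
    ext p
    simp [mul_add, Finset.sum_add_distrib]

-- Summation by parts with the indicator of `B₁` as weight: around a spanning face it jumps exactly
-- at the border corners.
open Classical in
theorem IsRefinedPartition.borderSum_coboundary (hr : G.IsRefinedPartition r)
    (g : G.Vertex → ZMod 2) (p : SpanningFace G r) : borderSum G r (G.coboundary g) p =
      ∑ d with d ∈ G.border r .A₂ .B₁, if G.faceOf d = p.1 then g (G.vertexOf d) else 0 := by
  have := G.sum_face_mul_coboundary (indicatorB₁ r) g p.1
  rw [← Finset.sum_filter, Finset.filter_filter]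
  refine Eq.trans ?_ (this.trans ?_)
  · refine Finset.sum_congr ?_ fun _ _ => rfl
    ext d
    simp
  · rw [Finset.sum_congr rfl fun d hd => by
      rw [hr.indicator_add p (Finset.mem_filter.1 hd).2, ite_mul, one_mul, zero_mul],
      ← Finset.sum_filter, Finset.filter_filter]
    refine Finset.sum_congr ?_ fun _ _ => rfl
    ext d
    simp [and_comm]

/-- The border uses exactly two corners at each vertex it meets, so every value of `g` occurs an
even number of times. -/
theorem IsRefinedPartition.sum_borderSum_coboundary [Fintype (SpanningFace G r)]
    (hr : G.IsRefinedPartition r) (g : G.Vertex → ZMod 2) :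
    ∑ p, borderSum G r (G.coboundary g) p = 0 := by
  classical
  simp only [hr.borderSum_coboundary]
  rw [Finset.sum_comm]
  have h1 : ∀ d ∈ Finset.univ.filter (fun d => d ∈ G.border r .A₂ .B₁),
      (∑ p : SpanningFace G r, if G.faceOf d = p.1 then g (G.vertexOf d) else 0) =
        ∑ s, if G.vertexOf d = s then g s else 0 := by
    intro d hd
    rw [Finset.sum_eq_single ⟨G.faceOf d, faceOf_border_spanning (Finset.mem_filter.1 hd).2⟩]
    · simp
    · intro p _ hp
      rw [if_neg]
      intro h
      exact hp (Subtype.ext h.symm)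
    · simp
  rw [Finset.sum_congr rfl h1, Finset.sum_comm]
  refine Finset.sum_eq_zero fun s _ => ?_
  rw [← Finset.sum_filter, Finset.filter_filter, Finset.sum_const]
  by_cases h : ∃ d ∈ G.border r .A₂ .B₁, G.vertexOf d = s
  · obtain ⟨d, hd, rfl⟩ := h
    have := (hr.border_A₂B₁.2.1 d hd).1
    rw [Set.ncard_eq_toFinset_card'] at this
    have h2 : (Finset.univ.filter fun a => a ∈ G.border r .A₂ .B₁ ∧
        G.vertexOf a = G.vertexOf d).card = 2 := by
      rw [← this]
      congr 1
      ext x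
      simp
    rw [h2, two_nsmul, CharTwo.add_self_eq_zero]
  · push Not at h
    rw [Finset.filter_false_of_mem]
    · simp
    · rintro d - ⟨hd, hs⟩
      exact h d hd hs

open Classical in
/-- The indicator of the face at a corner, among the faces between `A₂` and `B₁`. -/
noncomputable def faceIndicator (G : SurfaceGraph E) (r : E → Region) (d : E × Bool)
    (p : SpanningFace G r) : ZMod 2 := if G.faceOf d = p.1 then 1 else 0

open Classical in
theorem IsRefinedPartition.borderSum_starVec (hr : G.IsRefinedPartition r) {d d' : E × Bool}
    (hd : d ∈ G.border r .A₂ .B₁) (hd' : d' ∈ G.border r .A₂ .B₁)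
    (h : G.vertexOf d' = G.vertexOf d) (hne : d ≠ d') :
    borderSum G r (G.starVec (G.vertexOf d)) = faceIndicator G r d + faceIndicator G r d' := by
  ext p
  rw [← coboundary_single, hr.borderSum_coboundary]
  have h2 := (hr.border_A₂B₁.2.1 d hd).1
  have hset : ({d, d'} : Set (E × Bool)) =
      {x ∈ G.border r .A₂ .B₁ | G.vertexOf x = G.vertexOf d} := by
    refine Set.eq_of_subset_of_ncard_le ?_ ?_
    · rintro x (rfl | rfl)
      · exact ⟨hd, rfl⟩
      · exact ⟨hd', h⟩
    · rw [h2, Set.ncard_pair hne]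
  have hmem : ∀ x, (x ∈ G.border r .A₂ .B₁ ∧ G.vertexOf x = G.vertexOf d) ↔ x = d ∨ x = d' :=
    fun x => (Set.ext_iff.1 hset x).symm
  rw [← Finset.sum_filter, Finset.filter_filter, Pi.add_apply,
    ← Finset.sum_pair hne (f := fun x => faceIndicator G r x p)]
  simp only [faceIndicator, Pi.single_apply]
  rw [← Finset.sum_filter, ← Finset.sum_filter, Finset.filter_filter]
  refine Finset.sum_congr ?_ fun _ _ => rfl
  ext x
  have := hmem x
  simp only [Finset.mem_filter, Finset.mem_univ, true_and, Finset.mem_insert, Finset.mem_singleton]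
  tauto

/-- The contractible dual loops which avoid `B₂`. -/
def avoidingB₂ (G : SurfaceGraph E) (r : E → Region) : AddSubgroup (E → ZMod 2) where
  carrier := {w | w ∈ G.contractibleDualLoops ∧ ∀ e, r e = .B₂ → w e = 0}
  add_mem' {a b} ha hb := ⟨add_mem ha.1 hb.1, fun e he => by
    rw [Pi.add_apply, ha.2 e he, hb.2 e he, add_zero]⟩
  zero_mem' := ⟨zero_mem _, fun _ _ => rfl⟩
  neg_mem' {a} ha := ⟨neg_mem ha.1, fun e he => by rw [Pi.neg_apply, ha.2 e he, neg_zero]⟩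

theorem IsRefinedPartition.starVec_mem_avoidingB₂ (hr : G.IsRefinedPartition r) {d : E × Bool}
    (hd : d ∈ G.border r .A₂ .B₁) : G.starVec (G.vertexOf d) ∈ avoidingB₂ G r := by
  refine ⟨mem_contractibleDualLoops_iff_coboundary.2 ⟨_, (G.coboundary_single _).symm⟩, ?_⟩
  intro e he
  have : ∀ b, G.vertexOf (e, b) ≠ G.vertexOf d := fun b hb =>
    hr.region_of_border_vertex hd hb he
  simp [starVec, this]

/-- Induction along the connected border: a step through a vertex is realised by the star there, and
a step inside a face changes nothing. -/
theorem IsRefinedPartition.faceIndicator_add_mem (hr : G.IsRefinedPartition r) {d d' : E × Bool}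
    (hd : d ∈ G.border r .A₂ .B₁) (hd' : d' ∈ G.border r .A₂ .B₁) :
    faceIndicator G r d + faceIndicator G r d' ∈ (avoidingB₂ G r).map (borderSum G r) := by
  induction hr.border_A₂B₁.2.2 d hd d' hd' with
  | refl =>
    rw [ZModModule.add_self]
    exact zero_mem _
  | @tail x y _ hxy ih =>
    obtain ⟨hx, hy, h⟩ := hxy
    have hstep : faceIndicator G r x + faceIndicator G r y ∈
        (avoidingB₂ G r).map (borderSum G r) := by
      rcases h with h | h
      · by_cases hne : x = y
        · rw [hne, ZModModule.add_self]
          exact zero_mem _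
        · rw [← hr.borderSum_starVec hx hy h.symm hne]
          exact ⟨_, hr.starVec_mem_avoidingB₂ hx, rfl⟩
      · have : faceIndicator G r x = faceIndicator G r y := by
          ext p
          simp [faceIndicator, h]
        rw [this, ZModModule.add_self]
        exact zero_mem _
    have := add_mem (ih hx) hstep
    rwa [add_assoc, ← add_assoc (faceIndicator G r x), ZModModule.add_self, zero_add] at this

theorem IsRefinedPartition.mem_map_borderSum [Fintype (SpanningFace G r)]
    (hr : G.IsRefinedPartition r) (f : SpanningFace G r → ZMod 2) :
    f ∈ (avoidingB₂ G r).map (borderSum G r) ↔ ∑ p, f p = 0 := by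
  classical
  constructor
  · rintro ⟨w, hw, rfl⟩
    obtain ⟨g, rfl⟩ := mem_contractibleDualLoops_iff_coboundary.1 hw.1
    exact hr.sum_borderSum_coboundary g
  · intro hf
    obtain ⟨d₀, hd₀⟩ := hr.border_A₂B₁.1
    choose c hc hcp using hr.exists_border_of_spanning
    -- The added copies of the base corner's indicator cancel because `f` has even total.
    have hsum : f = ∑ p, f p • (faceIndicator G r (c p) + faceIndicator G r d₀) := by
      simp only [smul_add, Finset.sum_add_distrib, ← Finset.sum_smul, hf, zero_smul, add_zero]
      ext q
      simp [Finset.sum_apply, faceIndicator, hcp, Subtype.ext_iff.symm]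
    rw [hsum]
    refine sum_mem fun p _ => ?_
    have : ∀ x : ZMod 2, x = 0 ∨ x = 1 := by decide
    rcases this (f p) with h | h
    · rw [h, zero_smul]
      exact zero_mem _
    · rw [h, one_smul]
      exact hr.faceIndicator_add_mem (hc p) hd₀

/-- The total parity `σ` is onto since the border is nonempty, so its kernel has index two. The
factor `2` on the left avoids a subtraction in the exponent. -/
theorem IsRefinedPartition.two_mul_card_map_borderSum (hr : G.IsRefinedPartition r) :
    2 * Nat.card ((avoidingB₂ G r).map (borderSum G r)) = 2 ^ G.spanningPlaquettes r .A₂ .B₁ := by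
  classical
  have : Fintype (SpanningFace G r) := Fintype.ofFinite _
  let σ : (SpanningFace G r → ZMod 2) →+ ZMod 2 :=
    { toFun := fun f => ∑ p, f p
      map_zero' := by simp
      map_add' := fun f g => by simp [Finset.sum_add_distrib] }
  have hker : (avoidingB₂ G r).map (borderSum G r) = σ.ker := by
    ext f
    exact hr.mem_map_borderSum f
  have hσ : Function.Surjective σ := by
    obtain ⟨d₀, hd₀⟩ := hr.border_A₂B₁.1
    intro x
    refine ⟨Pi.single ⟨_, faceOf_border_spanning hd₀⟩ x, ?_⟩
    change ∑ p, Pi.single (M := fun _ => ZMod 2) _ x p = x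
    simp
  have h := σ.ker.card_mul_index
  rw [AddSubgroup.index_ker, AddMonoidHom.range_eq_top.2 hσ, AddSubgroup.card_top, Nat.card_zmod,
    Nat.card_fun, Nat.card_zmod, ← hker, mul_comm] at h
  rw [h]
  rfl

open Classical in
theorem borderSum_assemble (x : BitsA r × BitsOf r .B₁ × BitsOf r .B₂) (p : SpanningFace G r) :
    borderSum G r (assemble r x) p =
      ∑ d with G.faceOf d = p.1, assemble r ((0 : BitsA r), x.2.1, (0 : BitsOf r .B₂)) d.1 := by
  refine Finset.sum_congr (by ext; simp) fun d _ => ?_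
  rcases (r d.1).cases_A with h | h | h
  · rw [assemble_A _ h, assemble_A _ h, indicatorB₁, if_neg (by rcases h with h | h <;> simp [h])]
    simp
  · rw [assemble_B₁ _ h, assemble_B₁ _ h, indicatorB₁, if_pos h, one_mul]
  · rw [assemble_B₂ _ h, assemble_B₂ _ h, indicatorB₁, if_neg (by simp [h])]
    simp

/-- At a face meeting `B₁` but not `A₂`, only `B₁` and `B₂` edges occur, so `(0, b, 0)` inherits
evenness from `(a, b, 0)`; at the spanning faces evenness is the vanishing of the border sum.
Conversely, a completion inside `B` has no edge other than those of `b` at a spanning face. -/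
theorem IsRefinedPartition.borderSum_eq_zero_iff (hr : G.IsRefinedPartition r) {a : BitsA r}
    {b : BitsOf r .B₁} (h : (a, b, (0 : BitsOf r .B₂)) ∈ regionwise r G.contractibleDualLoops) :
    borderSum G r (assemble r (a, b, (0 : BitsOf r .B₂))) = 0 ↔
      b ∈ secondOfVanishingFirst (regionwise r G.dualLoops) := by
  classical
  have hZ : G.IsDualLoop (assemble r (a, b, (0 : BitsOf r .B₂))) :=
    mem_dualLoops.1 (contractibleDualLoops_le h)
  constructor
  · intro h0
    refine ⟨0, ?_⟩
    rw [mem_regionwise, mem_dualLoops]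
    intro p
    by_cases hB : G.PlaquetteTouches r p .B₁
    · by_cases hA : G.PlaquetteTouches r p .A₂
      · have := congrFun h0 ⟨p, hA, hB⟩
        rw [borderSum_assemble, Pi.zero_apply] at this
        convert this
      · rw [← hZ p]
        refine Finset.sum_congr rfl fun d hd => ?_
        have hd := (Finset.mem_filter.1 hd).2
        rcases (r d.1).cases_A with h | h | h
        · rcases h with h | h
          · exact absurd ⟨⟨d, hd, h⟩, hB⟩ (hr.noBorder_A₁B₁.2 p)
          · exact absurd ⟨d, hd, h⟩ hA
        · rw [assemble_B₁ _ h, assemble_B₁ _ h]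
        · rw [assemble_B₂ _ h, assemble_B₂ _ h]
    · refine Finset.sum_eq_zero fun d hd => ?_
      have hd := (Finset.mem_filter.1 hd).2
      rcases (r d.1).cases_A with h | h | h
      · rw [assemble_A _ h]
        rfl
      · exact absurd ⟨d, hd, h⟩ hB
      · rw [assemble_B₂ _ h]
        rfl
  · rintro ⟨c, hc⟩
    ext p
    rw [borderSum_assemble, Pi.zero_apply, ← mem_dualLoops.1 (mem_regionwise.1 hc) p.1]
    refine Finset.sum_congr (by ext; simp) fun d hd => ?_
    have hd := (Finset.mem_filter.1 hd).2
    rcases hr.region_of_spanning_face p hd with h | h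
    · rw [assemble_A _ (Or.inr h), assemble_A _ (Or.inr h)]
    · rw [assemble_B₁ _ h, assemble_B₁ _ h]

/-- The number of contractible dual loops avoiding `B₂`, in terms of the number of those whose part
in `B₁` can be completed within `B`. -/
theorem IsRefinedPartition.card_vanishingThird (hr : G.IsRefinedPartition r) :
    2 * Nat.card (vanishingThird (regionwise r G.contractibleDualLoops)) =
      2 ^ G.spanningPlaquettes r .A₂ .B₁ *
        Nat.card (localShifts (regionwise r G.dualLoops)
          (regionwise r G.contractibleDualLoops)) := by
  classical
  let Φ : vanishingThird (regionwise r G.contractibleDualLoops) →+ (SpanningFace G r → ZMod 2) :=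
    { toFun := fun s => borderSum G r (assemble r (s.1.1, s.1.2, (0 : BitsOf r .B₂)))
      map_zero' := by
        rw [← map_zero (borderSum G r), ← map_zero (assembleEquiv r)]
        rfl
      map_add' := fun s t => by
        rw [← map_add, ← assemble_add]
        simp }
  have hker : Φ.ker = localShifts (regionwise r G.dualLoops)
      (regionwise r G.contractibleDualLoops) := by
    ext s
    exact hr.borderSum_eq_zero_iff s.2
  have hrange : Φ.range = (avoidingB₂ G r).map (borderSum G r) := by
    ext f
    constructor
    · rintro ⟨s, rfl⟩
      exact ⟨_, ⟨s.2, fun e he => assemble_B₂ _ he⟩, rfl⟩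
    · rintro ⟨w, ⟨hw, hw0⟩, rfl⟩
      obtain ⟨⟨a, b, c⟩, rfl⟩ := (assembleEquiv r).surjective w
      have hc : c = 0 := by
        ext e
        have := hw0 e e.2
        rwa [assembleEquiv_apply, assemble_B₂ _ e.2] at this
      subst hc
      exact ⟨⟨(a, b), hw⟩, rfl⟩
  have h := Φ.ker.card_mul_index
  rw [AddSubgroup.index_ker, hrange, hker] at h
  rw [← h, ← hr.two_mul_card_map_borderSum]
  ring

end SurfaceGraph
end ToricCode

/-! ### The logarithmic negativity. -/

open ToricCode ToricCode.SurfaceGraph in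
theorem mainTheorem5 {E : Type*} [Fintype E] [DecidableEq E] (G : ToricCode.SurfaceGraph E)
    (hG : G.IsTorus) (r : E → ToricCode.Region) (hr : G.IsRefinedPartition r)
    (U J : ℝ) (hU : 0 < U) (hJ : 0 < J)
    (ψ : (E → Fin 2) → ℂ) (hψ : ToricCode.IsGroundState (G.hamiltonian U J) ψ) :
    ToricCode.logNegativityAB₁ r ψ = (G.spanningPlaquettes r .A₂ .B₁ : ℝ) - 1 := by
  obtain ⟨hsupp, hinv⟩ := groundState_support_and_invariance hU hJ hψ
  have htrace : (Nat.card (localShifts (regionwise r G.dualLoops)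
      (regionwise r G.contractibleDualLoops)) : ℝ) *
        (operatorAbs (partialTranspose (reducedAB₁ r ψ))).trace.re =
      Nat.card (vanishingThird (regionwise r G.contractibleDualLoops)) :=
    -- The group structures are supplied by hand: they come from `ZMod 2`, which is definitionally
    -- `Fin 2`.
    @card_mul_trace_operatorAbs (ConfigA r) (ConfigOf r .B₁) (ConfigOf r .B₂)
    (inferInstanceAs (AddCommGroup (BitsA r))) (inferInstanceAs (AddCommGroup (BitsOf r .B₁)))
    (inferInstanceAs (AddCommGroup (BitsOf r .B₂))) _ (fun x => ψ (assemble r x))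
    (regionwise r G.dualLoops) (regionwise r G.contractibleDualLoops) _ _ _ _
    (fun b => ZModModule.add_self (G := BitsOf r .B₁) b)
    (fun c => ZModModule.add_self (G := BitsOf r .B₂) c)
    (fun x hx => mem_dualLoops.2 (hsupp _ hx))
    (fun s hs z => by
      obtain ⟨g, hg⟩ := mem_contractibleDualLoops_iff_coboundary.1 (mem_regionwise.1 hs)
      refine (congrArg ψ (assemble_add z s)).trans ?_
      rw [hg]
      exact hinv g _)
    (hr.exists_shift_B₂ hG) (hr.exists_shift_A hG) (hr.exists_completion hG)
    ((Equiv.sum_comp (assembleEquiv r).toEquiv fun a => ‖ψ a‖ ^ 2).trans hψ.1)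
  have hcard := hr.card_vanishingThird
  have hpos : (0 : ℝ) <
      Nat.card (localShifts (regionwise r G.dualLoops) (regionwise r G.contractibleDualLoops)) := by
    exact_mod_cast Nat.card_pos
  have hT : (operatorAbs (partialTranspose (reducedAB₁ r ψ))).trace.re =
      2 ^ G.spanningPlaquettes r .A₂ .B₁ / 2 := by
    have hcard' := congrArg (Nat.cast : ℕ → ℝ) hcard
    push_cast at hcard'
    refine mul_left_cancel₀ hpos.ne' (htrace.trans ?_)
    linarith
  rw [logNegativityAB₁, logNegativity, hT, Real.logb_div (by positivity) two_ne_zero,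
    Real.logb_pow, Real.logb_self_eq_one one_lt_two, mul_one]
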